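/- **Setting.** Agents $1,\dots,N$ want to minimize $\sum_{i=1}^N f_i(y)$ over $\{y\in \mathcal X_0\subseteq\mathbb R^n : g(y,\omega)\le 0 \text{ for all } \omega\in\Omega_i \text{ and all } i\}$, where each $\Omega_i$ is a finite index set, and this problem has an optimal solution. Assume: $\mathcal X_0$ is nonempty, closed and convex; all $f_i$ and all $g(\cdot,\omega)$, $\omega\in\Omega_i$, are convex on an open convex set containing $\mathcal X_0$; the subgradients of each $f_i$, and those of all $g^+(\cdot,\omega)=\max\{g(\cdot,\omega),0\}$, at points of $\mathcal X_0$ are uniformly bounded. **Epigraph form.** In the variable $x=(y,t)\in\mathbb R^n\times\mathbb R^N$, minimize $a^\top x=\sum_{i} t_i$, where $a=(\mathbf 0,\mathbf 1)$, over the set $\mathcal X$ of all $(y,t)\in\mathcal X_0\times\mathbb R^N$ with $g(y,\omega)\le 0$ for all $\omega\in\Omega_i$ and all $i$, and $f_i(y)\le t_i$ for all $i$. Let $\mathcal X^*$ be its set of optimal solutions. Agent $i$ has the local objective $\frac1N a^\top x$, and its finite set $\Omega_i'$ of constraints consists of the constraints $g(y,\omega)\le 0$, $\omega\in\Omega_i$,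 and the constraint $f_i(y)-t_i\le 0$; write $h(x,\omega)\le 0$, $\omega\in\Omega'_i$, for these and $h^+=\max\{h,0\}$. **Algorithm (DAP).** Let $x_{i,0}\in\mathcal X_0\times\mathbb R^N$. For $k\ge1$ and every agent $i$, $$p_{i,k}=\sum_{j}[W_k]_{ij}\,x_{j,k-1},\qquad v_{i,k}=\Pi\Big[p_{i,k}-\alpha_k s_{i,k}\Big],\qquad x_{i,k}=\Pi\Big[v_{i,k}-\frac{h^+(v_{i,k},\omega_{i,k})}{\|d_{i,k}\|^2}\,d_{i,k}\Big],$$ where $\Pi$ is the Euclidean projection on $\mathcal X_0\times\mathbb R^N$, $s_{i,k}$ is a subgradient of $\frac1N a^\top x$ at $p_{i,k}$ (so $s_{i,k}=a/N$), and $d_{i,k}$ is a subgradient of $h^+(\cdot,\omega_{i,k})$ at $v_{i,k}$ if $h^+(v_{i,k},\omega_{i,k})>0$, and any nonzero vector otherwise. The weights are $[W_k]_{ij}=1/d_i(k)$ if $j=i$ or $(j,i)$ is an edge of the directed graph $\mathcal G_k$ on $\{1,\dots,N\}$, and $[W_k]_{ij}=0$ otherwise, where $d_i(k)$ is the number of $j$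 of the first kind. Assume: * every graph $\mathcal G_k$, $k\ge0$, is strongly connected; * $\alpha_k\ge0$ is nonincreasing, $\sum_{k\ge1}\alpha_k=\infty$ and $\sum_{k\ge1}\alpha_k^2<\infty$; * the random indices $\omega_{i,k}\in\Omega_i'$ are independent over all $i$ and $k\ge 1$; for each $i$ they have a common distribution, giving positive probability to each element of $\Omega'_i$; and the indices drawn at time $k$ are independent of the history of the algorithm up to time $k-1$; * there is $c>0$ such that $\operatorname{dist}^2(x,\mathcal X)\le c\sum_{i=1}^N \mathsf E\big[h^+(x,\omega_{i,1})^2\big]$ for all $x\in\mathcal X_0\times\mathbb R^N$. **Conclusion.** There is a random point $x^\star$, almost surely in $\mathcal X^*$, such that almost surely $\lim_{k\to\infty}x_{i,k}=x^\star$ for all agents $i$. -/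

import Mathlib

open MeasureTheory ProbabilityTheory Filter Topology
open scoped InnerProductSpace

namespace DAP

noncomputable section

/-! ### Communication graphs and weights -/

/-- In-neighborhood of agent `i`: all `j` with a link `(j, i)` (an edge from `j` to `i`),
together with `i` itself. -/
def inNbhd {N : ℕ} (G : Digraph (Fin N)) (i : Fin N) : Finset (Fin N) :=
  open Classical in {j | G.Adj j i ∨ j = i}

/-- In-degree of agent `i`, self-loop included. -/
def inDegree {N : ℕ} (G : Digraph (Fin N)) (i : Fin N) : ℕ := (inNbhd G i).card

/-- The row-stochastic weights `[W_k]_{ij} = 1 / d_i(k)` if `j` is an in-neighbor of `i` at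
time `k`, and `0` otherwise. -/
def rowWeights {N : ℕ} (G : ℕ → Digraph (Fin N)) (k : ℕ) : Matrix (Fin N) (Fin N) ℝ :=
  open Classical in
  Matrix.of fun i j => if j ∈ inNbhd (G k) i then 1 / (inDegree (G k) i : ℝ) else 0

/-- Any vertex can be reached from any other one along directed edges. -/
def IsStronglyConnected {N : ℕ} (G : Digraph (Fin N)) : Prop :=
  ∀ u v, Relation.ReflTransGen G.Adj u v

/-- The sequence of graphs is `Q`-strongly connected: for every `k`, the graph whose edge set is
the union of the edge sets at times `k, …, k + Q - 1` is strongly connected. -/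
def IsQStronglyConnected {N : ℕ} (Q : ℕ) (G : ℕ → Digraph (Fin N)) : Prop :=
  ∀ k, IsStronglyConnected ⟨fun u v => ∃ l < Q, (G (k + l)).Adj u v⟩

/-! ### Convex analysis -/

section Convex

variable {E : Type*} [NormedAddCommGroup E] [InnerProductSpace ℝ E]

/-- Subdifferential at `x` of a function `h` defined on `D`. -/
def subdifferential (D : Set E) (h : E → ℝ) (x : E) : Set E :=
  {s | ∀ y ∈ D, h x + ⟪s, y - x⟫_ℝ ≤ h y}

/-- `u` is the Euclidean projection of `x` on `S`: a point of `S` nearest to `x` (it is unique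
when `S` is nonempty, closed and convex). -/
def IsProjection (S : Set E) (x u : E) : Prop :=
  u ∈ S ∧ ∀ w ∈ S, ‖u - x‖ ≤ ‖w - x‖

end Convex

/-! ### The distributed optimization problem -/

/-- Data of the problem: minimize `∑ i, f i x` over the `x ∈ X₀` with `g ω x ≤ 0` for all
`ω ∈ Ω i` and all agents `i`. The index sets `Ω i` are finite and may overlap. The functions are
considered on `D` only, an open set containing `X₀`. -/
structure Problem (E : Type*) (N : ℕ) (I : Type*) where
  /-- the simple common constraint set -/
  X₀ : Set E
  /-- the set on which all functions are defined -/
  D : Set E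
  /-- the local objective functions -/
  f : Fin N → E → ℝ
  /-- the constraint functions -/
  g : I → E → ℝ
  /-- the finite index set of each agent -/
  Ω : Fin N → Finset I

namespace Problem

variable {E : Type*} {N : ℕ} {I : Type*}

/-- Global objective `f = ∑ i, f i`. -/
def objective (P : Problem E N I) (x : E) : ℝ := ∑ i, P.f i x

/-- Local constraint set of agent `i`. -/
def localSet (P : Problem E N I) (i : Fin N) : Set E := {x | ∀ ω ∈ P.Ω i, P.g ω x ≤ 0}

/-- Feasible set: `X₀` intersected with all the local constraint sets. -/
def feasible (P : Problem E N I) : Set E := P.X₀ ∩ ⋂ i, P.localSet i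

/-- Set of optimal solutions. -/
def optimalSet (P : Problem E N I) : Set E :=
  {x | x ∈ P.feasible ∧ ∀ y ∈ P.feasible, P.objective x ≤ P.objective y}

/-- Constraint violation `g⁺ = max (g, 0)`. -/
def gPlus (P : Problem E N I) (ω : I) (x : E) : ℝ := max (P.g ω x) 0

/-- Regularity of the data: `X₀` is nonempty, closed and convex; the objective and constraint
functions are convex on an open set containing `X₀`; the subgradients of `f i` and of `g⁺` are
uniformly bounded over `X₀`. -/
structure Regular [NormedAddCommGroup E] [InnerProductSpace ℝ E] (P : Problem E N I) :
    Prop where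
  nonempty : P.X₀.Nonempty
  isClosed : IsClosed P.X₀
  convex : Convex ℝ P.X₀
  isOpen_domain : IsOpen P.D
  subset_domain : P.X₀ ⊆ P.D
  convex_f : ∀ i, ConvexOn ℝ P.D (P.f i)
  bounded_f : ∀ i, ∃ C : ℝ, ∀ x ∈ P.X₀, ∀ s ∈ subdifferential P.D (P.f i) x, ‖s‖ ≤ C
  convex_g : ∀ i, ∀ ω ∈ P.Ω i, ConvexOn ℝ P.D (P.g ω)
  bounded_g : ∃ C : ℝ, ∀ i, ∀ ω ∈ P.Ω i, ∀ x ∈ P.X₀,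
    ∀ d ∈ subdifferential P.D (P.gPlus ω) x, ‖d‖ ≤ C

/-- Global error bound, for constraint indices of agent `i` drawn from the distribution `q i`:
the squared distance to the feasible set is bounded over `X₀` by a multiple of the total (over
the agents) expected squared violation. If each agent `i` separately satisfies
`dist² (x, feasible) ≤ cᵢ E[(g⁺ (x, ω))²]` with `ω` drawn from `q i`, then this holds as well
(for `1 ≤ N`); the converse fails. -/
def ErrorBound [PseudoMetricSpace E] (P : Problem E N I) (q : Fin N → PMF I) : Prop :=
  ∃ c : ℝ, 0 < c ∧ ∀ x ∈ P.X₀,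
    Metric.infDist x P.feasible ^ 2 ≤ c * ∑ i, ∑ j ∈ P.Ω i, (q i j).toReal * P.gPlus j x ^ 2

end Problem

/-! ### The epigraph form -/

/-- The space of the variables `x = (y, t)`, with the Euclidean norm. -/
abbrev EpiSpace (n N : ℕ) : Type :=
  WithLp 2 (EuclideanSpace ℝ (Fin n) × EuclideanSpace ℝ (Fin N))

/-- The vector `a = (0, 𝟏)`, so that `⟪a, (y, t)⟫ = ∑ i, t i`. -/
def epiCost (n N : ℕ) : EpiSpace n N := WithLp.toLp 2 (0, WithLp.toLp 2 fun _ => 1)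

/-- Epigraph form of a problem, in the variables `x = (y, t)`: minimize `⟪a, x⟫` subject to
`y ∈ X₀`, to the original constraints on `y`, and to `f i y ≤ t i` for every agent `i`. The
additional inequality is one more constraint (with index `Sum.inr i`) of agent `i`; the objective
is split evenly, every agent having the local objective `(1 / N) ⟪a, x⟫`. -/
def Problem.epigraph {n N : ℕ} {I : Type*} (P : Problem (EuclideanSpace ℝ (Fin n)) N I) :
    Problem (EpiSpace n N) N (I ⊕ Fin N) where
  X₀ := {x | x.fst ∈ P.X₀}
  D := {x | x.fst ∈ P.D}
  f := fun _ x => (1 / (N : ℝ)) * ⟪epiCost n N, x⟫_ℝ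
  g := Sum.elim (fun ω x => P.g ω x.fst) (fun i x => P.f i x.fst - x.snd i)
  Ω := fun i => (P.Ω i).disjSum {i}

/-! ### Stepsizes, random constraint indices, and the algorithm -/

/-- Nonnegative nonincreasing stepsizes with `∑ α_k = ∞` and `∑ α_k² < ∞` (sums over `k ≥ 1`). -/
structure IsStepsize (α : ℕ → ℝ) : Prop where
  nonneg : ∀ k, 0 ≤ α k
  antitone : Antitone α
  not_summable : ¬ Summable fun k => α (k + 1)
  summable_sq : Summable fun k => α (k + 1) ^ 2

/-- Random constraint indices `ω i k ∈ Ω i`, `k ≥ 1`: for each agent `i` they have a common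
distribution `q i`, which gives positive probability to each element of `Ω i` (and to no other
index), and they are independent across times and agents. -/
structure IsIIDSampling {S : Type*} [MeasurableSpace S] (μ : Measure S) {N : ℕ} {I : Type*}
    [MeasurableSpace I] (Ω : Fin N → Finset I) (q : Fin N → PMF I)
    (ω : Fin N → ℕ → S → I) : Prop where
  support : ∀ i, (q i).support = ↑(Ω i)
  measurable : ∀ i k, Measurable (ω i (k + 1))
  mem : ∀ i k w, ω i (k + 1) w ∈ Ω i
  law : ∀ i k j, μ (ω i (k + 1) ⁻¹' {j}) = q i j
  indep : iIndepFun (fun (a : Fin N × ℕ) => ω a.1 (a.2 + 1)) μ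

/-- One realization of the decentralized approximate projection (DAP) algorithm on the problem
`P`, with weight matrices `W k`, stepsizes `α k` and constraint indices `ω i k`. Iteration
`k + 1` turns `x i k` into `x i (k + 1)`. -/
structure IsDAP {E : Type*} [NormedAddCommGroup E] [InnerProductSpace ℝ E] {N : ℕ} {I : Type*}
    (P : Problem E N I) (W : ℕ → Matrix (Fin N) (Fin N) ℝ) (α : ℕ → ℝ) (ω : Fin N → ℕ → I)
    (x p s v d : Fin N → ℕ → E) : Prop where
  init : ∀ i, x i 0 ∈ P.X₀
  average : ∀ i k, p i (k + 1) = ∑ j, W (k + 1) i j • x j k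
  subgrad_f : ∀ i k, s i (k + 1) ∈ subdifferential P.D (P.f i) (p i (k + 1))
  descent : ∀ i k, IsProjection P.X₀ (p i (k + 1) - α (k + 1) • s i (k + 1)) (v i (k + 1))
  subgrad_g : ∀ i k, 0 < P.gPlus (ω i (k + 1)) (v i (k + 1)) →
    d i (k + 1) ∈ subdifferential P.D (P.gPlus (ω i (k + 1))) (v i (k + 1))
  ne_zero : ∀ i k, P.gPlus (ω i (k + 1)) (v i (k + 1)) = 0 → d i (k + 1) ≠ 0
  feasibility : ∀ i k, IsProjection P.X₀
    (v i (k + 1) -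
      (P.gPlus (ω i (k + 1)) (v i (k + 1)) / ‖d i (k + 1)‖ ^ 2) • d i (k + 1)) (x i (k + 1))

/-- `ℱ k` describes the history of the algorithm up to time `k`: the iterates and the indices up
to time `k` are known, and the indices drawn at time `k + 1` are independent of it. -/
structure IsHistory {S : Type*} {mS : MeasurableSpace S} (μ : Measure S) {N : ℕ} {E I : Type*}
    [TopologicalSpace E] [MeasurableSpace I] (ℱ : Filtration ℕ mS)
    (ω : Fin N → ℕ → S → I) (x : Fin N → ℕ → S → E) : Prop where
  iterates : ∀ i, StronglyAdapted ℱ (x i)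
  indices : ∀ i k, Measurable[ℱ (k + 1)] (ω i (k + 1))
  indep : ∀ k, Indep (ℱ k) (⨆ i, MeasurableSpace.comap (ω i (k + 1)) inferInstance) μ

end

end DAP

/-!
In epigraph form all agents share one linear objective `⟪c₀, ·⟫` with `c₀ = a / N`, and for such a
problem the row-stochastic weights do no harm: reweighting the agents does not change the
objective.

Let `π k` be an absolute probability sequence of the weights, that is, probability vectors with
`π (k + 1) W (k + 1) = π k` (`exists_absolute_probability`). As all graphs are strongly connected,
its entries are bounded away from zero (`inv_pow_le_absolute_probability`). For an optimal point
`z`, the Lyapunov function `V k = ∑ i, π k i * ‖x i k - z‖ ^ 2` is not increased by the averaging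
step; by the bias-variance identity it even decreases by a multiple of the squared disagreement
of the agents. The descent step costs `O (α ^ 2)` and gains the suboptimality of the iterates, and
the approximate projection decreases `V` in proportion to the squared violation of the constraint
drawn. The conditional expectation of that violation controls the squared distance to the feasible
set by the error bound. Altogether (`IsDAP.lyapunov_step`),
`V (k + 1) + Φ k + noise ≤ V k + O (α (k + 1) ^ 2)`, where `Φ` collects the disagreement, the squared
distance to the feasible set and `α` times the suboptimality, and the noise is centered given the
past.

The initial points need not have moments, so the martingale convergence theorem is applied on the
events `{V 0 ≤ M}` (`ae_tendsto_and_summable_of_almost_supermartingale`). It follows that almost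
surely `V` converges, simultaneously for all `z` in a countable dense set of optimal points, and
`∑ Φ k` is finite. Since `∑ α k = ∞`, a subsequence of the iterates then converges to an optimal
point, and the convergence of the Lyapunov functions makes that point the limit of all the iterates
(`exists_tendsto_of_lyapunov`).

For the epigraph form it remains to bound the subgradients of the violation of `f i y ≤ t i`
(`subdifferential_epigraph_inr`).
-/

namespace DAP

/-! ### Projections and subgradients -/

section Convex

variable {E : Type*} [NormedAddCommGroup E] [InnerProductSpace ℝ E]

theorem IsProjection.inner_le_zero {S : Set E} (hS : Convex ℝ S) {x u w : E}
    (h : IsProjection S x u) (hw : w ∈ S) : ⟪x - u, w - u⟫_ℝ ≤ 0 := by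
  refine (norm_eq_iInf_iff_real_inner_le_zero hS h.1).1 ?_ w hw
  have : Nonempty S := ⟨⟨u, h.1⟩⟩
  refine le_antisymm (le_ciInf fun w => ?_) (ciInf_le ⟨0, ?_⟩ (⟨u, h.1⟩ : S))
  · rw [norm_sub_rev, norm_sub_rev x]
    exact h.2 w w.2
  · rintro _ ⟨w, rfl⟩
    exact norm_nonneg _

theorem IsProjection.norm_sub_le {S : Set E} (hS : Convex ℝ S) {x y u w : E}
    (hu : IsProjection S x u) (hw : IsProjection S y w) : ‖u - w‖ ≤ ‖x - y‖ := by
  have h1 := hu.inner_le_zero hS hw.1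
  have h2 := hw.inner_le_zero hS hu.1
  have h3 : ‖u - w‖ ^ 2 ≤ ⟪x - y, u - w⟫_ℝ := by
    have : ⟪x - y, u - w⟫_ℝ - ‖u - w‖ ^ 2 = -⟪x - u, w - u⟫_ℝ - ⟪y - w, u - w⟫_ℝ := by
      rw [← real_inner_self_eq_norm_sq]
      simp only [inner_sub_left, inner_sub_right]
      ring
    linarith
  have h4 := real_inner_le_norm (x - y) (u - w)
  by_contra! hlt
  nlinarith [norm_nonneg (x - y)]

theorem isProjection_self {E : Type*} [NormedAddCommGroup E] {S : Set E} {x : E} (hx : x ∈ S) :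
    IsProjection S x x :=
  ⟨hx, fun w _ => by simp⟩

theorem IsProjection.norm_sub_le_of_mem {S : Set E} (hS : Convex ℝ S) {x u w : E}
    (hu : IsProjection S x u) (hw : w ∈ S) : ‖u - w‖ ≤ ‖x - w‖ :=
  hu.norm_sub_le hS (isProjection_self hw)

theorem IsProjection.eq {S : Set E} (hS : Convex ℝ S) {x u w : E}
    (hu : IsProjection S x u) (hw : IsProjection S x w) : u = w := by
  have := hu.norm_sub_le hS hw
  rw [sub_self, norm_zero, norm_le_zero_iff, sub_eq_zero] at this
  exact this

/-- The projection on a nonempty closed convex set of a complete space, as a continuous map. -/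
theorem exists_continuous_isProjection [CompleteSpace E] {S : Set E} (hne : S.Nonempty)
    (hcl : IsClosed S) (hS : Convex ℝ S) :
    ∃ proj : E → E, Continuous proj ∧ ∀ x, IsProjection S x (proj x) := by
  have h : ∀ x, ∃ u, IsProjection S x u := by
    intro x
    obtain ⟨u, hu, hxu⟩ := exists_norm_eq_iInf_of_complete_convex hne hcl.isComplete hS x
    refine ⟨u, hu, fun w hw => ?_⟩
    rw [norm_sub_rev, hxu, norm_sub_rev]
    exact ciInf_le ⟨0, by rintro _ ⟨w, rfl⟩; exact norm_nonneg _⟩ (⟨w, hw⟩ : S)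
  choose proj hproj using h
  refine ⟨proj, ?_, hproj⟩
  refine (LipschitzWith.of_dist_le_mul (K := 1) fun x y => ?_).continuous
  simpa [dist_eq_norm] using (hproj x).norm_sub_le hS (hproj y)

/-- A convex function on an open set of a finite-dimensional space has subgradients everywhere:
separate a point of the graph from the open strict epigraph. -/
theorem subdifferential_nonempty [FiniteDimensional ℝ E] {D : Set E} (hD : IsOpen D)
    {φ : E → ℝ} (hφ : ConvexOn ℝ D φ) {x : E} (hx : x ∈ D) :
    (subdifferential D φ x).Nonempty := by
  have : CompleteSpace E := FiniteDimensional.complete ℝ E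
  have hopen : IsOpen {p : E × ℝ | p.1 ∈ D ∧ φ p.1 < p.2} := by
    have hc : ContinuousOn (fun p : E × ℝ => p.2 - φ p.1) {p : E × ℝ | p.1 ∈ D} :=
      continuous_snd.continuousOn.sub
        ((hφ.continuousOn hD).comp continuous_fst.continuousOn fun p hp => hp)
    have h := hc.isOpen_inter_preimage (hD.preimage continuous_fst) (isOpen_Ioi (a := (0 : ℝ)))
    convert h using 1
    ext p
    simp [sub_pos]
  obtain ⟨ℓ, hℓ⟩ := geometric_hahn_banach_open_point hφ.convex_strict_epigraph hopen
    (x := (x, φ x)) (by simp)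
  set c : ℝ := ℓ (0, 1) with hc
  have hsplit : ∀ y r, ℓ (y, r) = ℓ (y, 0) + r * c := by
    intro y r
    rw [hc, ← smul_eq_mul, ← map_smul, ← map_add]
    simp
  have hc0 : c < 0 := by
    have := hℓ (x, φ x + 1) ⟨hx, by simp⟩
    rw [hsplit x (φ x + 1), hsplit x (φ x)] at this
    linarith
  have hle : ∀ y ∈ D, ℓ (y, 0) + φ y * c ≤ ℓ (x, 0) + φ x * c := by
    intro y hy
    refine le_of_forall_pos_le_add fun ε hε => ?_
    have hpos : 0 < ε / (-c) := div_pos hε (by linarith)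
    have := hℓ (y, φ y + ε / (-c)) ⟨hy, by simpa using hpos⟩
    rw [hsplit y, hsplit x] at this
    have he : ε / (-c) * c = -ε := by
      have := hc0.ne
      field_simp
    nlinarith
  let ℓ₁ : E →L[ℝ] ℝ := ℓ.comp (ContinuousLinearMap.inl ℝ E ℝ)
  refine ⟨(-c)⁻¹ • (InnerProductSpace.toDual ℝ E).symm ℓ₁, fun y hy => ?_⟩
  have hl : ℓ₁ (y - x) = ℓ (y, 0) - ℓ (x, 0) := by
    rw [map_sub]; rfl
  rw [real_inner_smul_left, InnerProductSpace.toDual_symm_apply, hl]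
  have h1 := hle y hy
  have hc' : 0 < (-c)⁻¹ := inv_pos.2 (by linarith)
  have h2 : (-c)⁻¹ * (-c) = 1 := inv_mul_cancel₀ (by linarith)
  have h3 : (-c)⁻¹ * (ℓ (y, 0) - ℓ (x, 0)) ≤ (-c)⁻¹ * ((φ y - φ x) * (-c)) :=
    mul_le_mul_of_nonneg_left (by linarith) hc'.le
  have h4 : (-c)⁻¹ * ((φ y - φ x) * (-c)) = (φ y - φ x) * ((-c)⁻¹ * (-c)) := by ring
  rw [h4, h2] at h3
  linarith

/-- Bounded subgradients at `x` make a convex function decrease from `x` at bounded slope. -/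
theorem sub_le_of_subdifferential_bounded [FiniteDimensional ℝ E] {D : Set E} (hD : IsOpen D)
    {φ : E → ℝ} (hφ : ConvexOn ℝ D φ) {x y : E} (hx : x ∈ D) (hy : y ∈ D) {C : ℝ}
    (hC : ∀ d ∈ subdifferential D φ x, ‖d‖ ≤ C) : φ x - φ y ≤ C * ‖x - y‖ := by
  obtain ⟨d, hd⟩ := subdifferential_nonempty hD hφ hx
  have h1 := hd y hy
  have h2 := neg_le_of_abs_le (abs_real_inner_le_norm d (y - x))
  have h3 : ‖d‖ * ‖y - x‖ ≤ C * ‖x - y‖ := by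
    rw [norm_sub_rev]
    exact mul_le_mul_of_nonneg_right (hC d hd) (norm_nonneg _)
  linarith

theorem eq_of_mem_subdifferential_inner {D : Set E} (hD : IsOpen D) {a s x : E} (hx : x ∈ D)
    (hs : s ∈ subdifferential D (fun y => ⟪a, y⟫_ℝ) x) : s = a := by
  have hcont : Continuous fun τ : ℝ => x + τ • (s - a) := by fun_prop
  have h0 : ∀ᶠ τ : ℝ in 𝓝 0, x + τ • (s - a) ∈ D :=
    hcont.continuousAt.eventually_mem (by simpa using hD.mem_nhds hx)
  obtain ⟨τ, hτD, hτ⟩ := ((h0.filter_mono nhdsWithin_le_nhds).and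
    (self_mem_nhdsWithin : Set.Ioi (0 : ℝ) ∈ 𝓝[>] 0)).exists
  have h := hs _ hτD
  simp only [add_sub_cancel_left, inner_add_right, real_inner_smul_right] at h
  have h2 : τ * ‖s - a‖ ^ 2 ≤ 0 := by
    rw [← real_inner_self_eq_norm_sq, inner_sub_left]
    linarith
  have h3 : ‖s - a‖ ^ 2 ≤ 0 := by
    by_contra! hpos
    exact absurd h2 (not_le.2 (mul_pos hτ hpos))
  have h4 : ‖s - a‖ = 0 := by nlinarith [norm_nonneg (s - a)]
  exact sub_eq_zero.1 (norm_eq_zero.1 h4)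

/-- One approximate projection step on a sublevel set `{φ ≤ 0}` with `φ ≥ 0`: the Polyak step
decreases the squared distance to every point of the sublevel set in proportion to the squared
violation. -/
theorem IsProjection.sq_norm_sub_le_of_polyak {S D : Set E} (hS : Convex ℝ S) (hSD : S ⊆ D)
    {φ : E → ℝ} {v d x z : E} (hz : z ∈ S) (hφz : φ z = 0) (hφ : 0 ≤ φ v)
    {C : ℝ}
    (hd : 0 < φ v → d ∈ subdifferential D φ v ∧ ‖d‖ ≤ C)
    (hx : IsProjection S (v - (φ v / ‖d‖ ^ 2) • d) x) :
    ‖x - z‖ ^ 2 ≤ ‖v - z‖ ^ 2 - φ v ^ 2 / C ^ 2 := by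
  have h1 := pow_le_pow_left₀ (norm_nonneg _) (hx.norm_sub_le_of_mem hS hz) 2
  rcases hφ.eq_or_lt with h0 | hpos
  · rw [← h0] at h1 ⊢
    simpa using h1
  obtain ⟨hds, hdC⟩ := hd hpos
  have h2 := hds z (hSD hz)
  rw [hφz] at h2
  have hd0 : d ≠ 0 := by
    rintro rfl
    simp at h2
    linarith
  have hdn : 0 < ‖d‖ := norm_pos_iff.2 hd0
  have h3 : ‖v - (φ v / ‖d‖ ^ 2) • d - z‖ ^ 2
      = ‖v - z‖ ^ 2 + 2 * (φ v / ‖d‖ ^ 2) * ⟪d, z - v⟫_ℝ + φ v ^ 2 / ‖d‖ ^ 2 := by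
    have : v - (φ v / ‖d‖ ^ 2) • d - z = (v - z) - (φ v / ‖d‖ ^ 2) • d := by abel
    rw [this, norm_sub_sq_real, real_inner_smul_right, norm_smul, real_inner_comm d,
      show z - v = -(v - z) by abel, inner_neg_right, Real.norm_of_nonneg (by positivity)]
    field_simp
    ring
  have h4 : 2 * (φ v / ‖d‖ ^ 2) * ⟪d, z - v⟫_ℝ ≤ 2 * (φ v / ‖d‖ ^ 2) * (-φ v) :=
    mul_le_mul_of_nonneg_left (by linarith) (by positivity)
  have h5 : φ v ^ 2 / C ^ 2 ≤ φ v ^ 2 / ‖d‖ ^ 2 := by gcongr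
  have h6 : 2 * (φ v / ‖d‖ ^ 2) * (-φ v) = -2 * (φ v ^ 2 / ‖d‖ ^ 2) := by ring
  linarith

end Convex

/-! ### Communication graphs, weights and the absolute probability sequence -/

section Graph

variable {N : ℕ}

theorem IsQStronglyConnected.isStronglyConnected {G : ℕ → Digraph (Fin N)}
    (hG : IsQStronglyConnected 1 G) (k : ℕ) : IsStronglyConnected (G k) := by
  have h := hG k
  simpa [IsStronglyConnected] using h

theorem self_mem_inNbhd (G : Digraph (Fin N)) (i : Fin N) : i ∈ inNbhd G i := by
  simp [inNbhd]

theorem mem_inNbhd_of_adj {G : Digraph (Fin N)} {i j : Fin N} (h : G.Adj j i) :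
    j ∈ inNbhd G i := by
  simp [inNbhd, h]

theorem inDegree_pos (G : Digraph (Fin N)) (i : Fin N) : 0 < inDegree G i :=
  Finset.card_pos.2 ⟨i, self_mem_inNbhd G i⟩

theorem rowWeights_nonneg (G : ℕ → Digraph (Fin N)) (k : ℕ) (i j : Fin N) :
    0 ≤ rowWeights G k i j := by
  simp only [rowWeights, Matrix.of_apply]
  split_ifs <;> positivity

theorem sum_rowWeights (G : ℕ → Digraph (Fin N)) (k : ℕ) (i : Fin N) :
    ∑ j, rowWeights G k i j = 1 := by
  have h := inDegree_pos (G k) i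
  simp only [rowWeights, Matrix.of_apply, Finset.sum_ite_mem, Finset.univ_inter,
    Finset.sum_const, nsmul_eq_mul]
  rw [← inDegree]
  field_simp

theorem inv_le_rowWeights {G : ℕ → Digraph (Fin N)} {k : ℕ} {i j : Fin N}
    (h : j ∈ inNbhd (G k) i) : (N : ℝ)⁻¹ ≤ rowWeights G k i j := by
  simp only [rowWeights, Matrix.of_apply, if_pos h, one_div]
  have h1 := inDegree_pos (G k) i
  have h2 : inDegree (G k) i ≤ N := by
    simpa [inDegree] using Finset.card_le_univ (inNbhd (G k) i)
  gcongr

theorem exists_adj_of_reflTransGen {G : Digraph (Fin N)} {A : Fin N → Prop} {u v : Fin N}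
    (h : Relation.ReflTransGen G.Adj u v) (hu : A u) (hv : ¬ A v) :
    ∃ l i, A l ∧ ¬ A i ∧ G.Adj l i := by
  induction h with
  | refl => exact absurd hu hv
  | @tail b c _ hbc ih =>
    by_cases hb : A b
    · exact ⟨b, c, hb, hv, hbc⟩
    · exact ih hb

/-- Information spreading along strongly connected graphs reaches all `N` agents in `N` steps: as
long as some agent is not informed, an edge leaves the set of informed agents. -/
theorem forall_of_spreading {G : ℕ → Digraph (Fin N)} (hG : ∀ t, IsStronglyConnected (G t))
    {A : ℕ → Fin N → Prop} (h0 : ∃ i, A 0 i) (hmono : ∀ t i, A t i → A (t + 1) i)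
    (hstep : ∀ t l i, A t l → (G t).Adj l i → A (t + 1) i) (i : Fin N) : A N i := by
  classical
  obtain ⟨i₀, hi₀⟩ := h0
  have hi : ∀ t, A t i₀ := fun t => Nat.rec hi₀ (fun t => hmono t i₀) t
  have hall : ∀ t, (∀ i, A t i) ∨ t + 1 ≤ (Finset.univ.filter (A t)).card := by
    intro t
    induction t with
    | zero => exact Or.inr (Finset.card_pos.2 ⟨i₀, by simpa using hi₀⟩)
    | succ t ih =>
      rcases ih with ih | ih
      · exact Or.inl fun i => hmono t i (ih i)
      · by_cases hA : ∀ i, A t i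
        · exact Or.inl fun i => hmono t i (hA i)
        · push Not at hA
          obtain ⟨v, hv⟩ := hA
          obtain ⟨l, i, hl, hni, hli⟩ := exists_adj_of_reflTransGen (hG t i₀ v) (hi t) hv
          refine Or.inr (Nat.succ_le_of_lt (lt_of_le_of_lt ih (Finset.card_lt_card ?_)))
          rw [Finset.ssubset_iff_of_subset fun j hj => by
            simp only [Finset.mem_filter, Finset.mem_univ, true_and] at hj ⊢
            exact hmono t j hj]
          exact ⟨i, by simpa using hstep t l i hl hli, by simpa using hni⟩
  rcases hall N with h | h
  · exact h i
  · have := Finset.card_le_univ (Finset.univ.filter (A N))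
    simp only [Fintype.card_fin] at this
    omega

theorem vecMul_mem_stdSimplex {W : Matrix (Fin N) (Fin N) ℝ} (hW0 : ∀ i j, 0 ≤ W i j)
    (hW1 : ∀ i, ∑ j, W i j = 1) {u : Fin N → ℝ} (hu : u ∈ stdSimplex ℝ (Fin N)) :
    Matrix.vecMul u W ∈ stdSimplex ℝ (Fin N) := by
  simp only [stdSimplex, Set.mem_ofPred_eq, Matrix.vecMul, dotProduct]
  refine ⟨fun j => Finset.sum_nonneg fun i _ => mul_nonneg (hu.1 i) (hW0 i j), ?_⟩
  rw [Finset.sum_comm]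
  simp [← Finset.mul_sum, hW1, hu.2]

/-- Row-stochastic matrices have an absolute probability sequence: probability vectors `π k` with
`π (k + 1) W (k + 1) = π k` for all `k`. Backward recursion solves finitely many of these
equations, and compactness all of them. -/
theorem exists_absolute_probability (hN : 0 < N) (W : ℕ → Matrix (Fin N) (Fin N) ℝ)
    (hW0 : ∀ k i j, 0 ≤ W k i j) (hW1 : ∀ k i, ∑ j, W k i j = 1) :
    ∃ π : ℕ → Fin N → ℝ, (∀ k, π k ∈ stdSimplex ℝ (Fin N)) ∧
      ∀ k, Matrix.vecMul (π (k + 1)) (W (k + 1)) = π k := by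
  let K : ℕ → Set (ℕ → Fin N → ℝ) := fun m =>
    {π | (∀ k, π k ∈ stdSimplex ℝ (Fin N)) ∧
      ∀ k < m, Matrix.vecMul (π (k + 1)) (W (k + 1)) = π k}
  have hne : ∀ m, ∀ W : ℕ → Matrix (Fin N) (Fin N) ℝ, (∀ k i j, 0 ≤ W k i j) →
      (∀ k i, ∑ j, W k i j = 1) → ∃ π : ℕ → Fin N → ℝ, (∀ k, π k ∈ stdSimplex ℝ (Fin N)) ∧
        ∀ k < m, Matrix.vecMul (π (k + 1)) (W (k + 1)) = π k := by
    intro m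
    induction m with
    | zero =>
      intro W _ _
      exact ⟨fun _ => Pi.single ⟨0, hN⟩ 1, fun _ => single_mem_stdSimplex ℝ _, by simp⟩
    | succ m ih =>
      intro W h0 h1
      obtain ⟨π, hπ, hrec⟩ := ih (fun k => W (k + 1)) (fun k => h0 _) (fun k => h1 _)
      refine ⟨fun k => Nat.casesOn k (Matrix.vecMul (π 0) (W 1)) π, ?_, ?_⟩
      · rintro (_ | k)
        · exact vecMul_mem_stdSimplex (h0 1) (h1 1) (hπ 0)
        · exact hπ k
      · rintro (_ | k) hk
        · rfl
        · exact hrec k (by omega)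
  have hclosed : ∀ m, IsClosed (K m) := by
    intro m
    have h1 : IsClosed {π : ℕ → Fin N → ℝ | ∀ k, π k ∈ stdSimplex ℝ (Fin N)} := by
      rw [Set.ofPred_forall]
      exact isClosed_iInter fun k =>
        (isClosed_stdSimplex ℝ (Fin N)).preimage (continuous_apply k)
    have h2 : IsClosed {π : ℕ → Fin N → ℝ |
        ∀ k < m, Matrix.vecMul (π (k + 1)) (W (k + 1)) = π k} := by
      simp only [Set.ofPred_forall]
      exact isClosed_iInter fun k => isClosed_iInter fun _ =>
        isClosed_eq (by fun_prop) (by fun_prop)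
    exact h1.inter h2
  have hcompact : IsCompact (K 0) := by
    convert isCompact_univ_pi (fun _ : ℕ => isCompact_stdSimplex ℝ (Fin N)) using 1
    ext π
    simp [K]
  obtain ⟨π, hπ⟩ := IsCompact.nonempty_iInter_of_sequence_nonempty_isCompact_isClosed K
    (fun m π hπ => ⟨hπ.1, fun k hk => hπ.2 k (by omega)⟩) (fun m => hne m W hW0 hW1)
    hcompact hclosed
  rw [Set.mem_iInter] at hπ
  exact ⟨π, (hπ 0).1, fun k => (hπ (k + 1)).2 k (by omega)⟩

/-- For strongly connected graphs every absolute probability sequence of the weights is bounded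
away from zero, as all products of `N` consecutive weight matrices have entries at least
`N ^ (-N)`. -/
theorem inv_pow_le_absolute_probability {G : ℕ → Digraph (Fin N)}
    (hG : ∀ k, IsStronglyConnected (G k)) {π : ℕ → Fin N → ℝ}
    (hπ : ∀ k, π k ∈ stdSimplex ℝ (Fin N))
    (hrec : ∀ k, Matrix.vecMul (π (k + 1)) (rowWeights G (k + 1)) = π k) (k : ℕ) (j : Fin N) :
    (N : ℝ)⁻¹ ^ N ≤ π k j := by
  let M : ℕ → Matrix (Fin N) (Fin N) ℝ := fun t =>
    Nat.rec 1 (fun t A => rowWeights G (k + t + 1) * A) t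
  have hMs : ∀ t, M (t + 1) = rowWeights G (k + t + 1) * M t := fun t => rfl
  have hM0 : ∀ t i l, 0 ≤ M t i l := by
    intro t
    induction t with
    | zero =>
      intro i l
      change 0 ≤ (1 : Matrix (Fin N) (Fin N) ℝ) i l
      rw [Matrix.one_apply]
      split_ifs <;> norm_num
    | succ t ih =>
      intro i l
      rw [hMs, Matrix.mul_apply]
      exact Finset.sum_nonneg fun m _ => mul_nonneg (rowWeights_nonneg G _ i m) (ih m l)
  have hMπ : ∀ t, Matrix.vecMul (π (k + t)) (M t) = π k := by
    intro t
    induction t with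
    | zero => exact Matrix.vecMul_one _
    | succ t ih => rw [hMs, ← Matrix.vecMul_vecMul, ← add_assoc, hrec, ih]
  have hstep : ∀ t l i, (N : ℝ)⁻¹ ^ t ≤ M t l j → l ∈ inNbhd (G (k + t + 1)) i →
      (N : ℝ)⁻¹ ^ (t + 1) ≤ M (t + 1) i j := by
    intro t l i hl hli
    rw [hMs, Matrix.mul_apply, pow_succ']
    refine le_trans ?_ (Finset.single_le_sum
      (fun m _ => mul_nonneg (rowWeights_nonneg G _ i m) (hM0 t m j)) (Finset.mem_univ l))
    exact mul_le_mul (inv_le_rowWeights hli) hl (by positivity) (rowWeights_nonneg G _ i l)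
  have hall : ∀ i, (N : ℝ)⁻¹ ^ N ≤ M N i j := by
    refine forall_of_spreading (G := fun t => G (k + t + 1)) (fun t => hG _)
      (A := fun t i => (N : ℝ)⁻¹ ^ t ≤ M t i j) ⟨j, ?_⟩ ?_ ?_
    · change (N : ℝ)⁻¹ ^ 0 ≤ (1 : Matrix (Fin N) (Fin N) ℝ) j j
      simp
    · exact fun t i hi => hstep t i i hi (self_mem_inNbhd _ i)
    · exact fun t l i hl hli => hstep t l i hl (mem_inNbhd_of_adj hli)
  rw [← hMπ N]
  calc (N : ℝ)⁻¹ ^ N = ∑ i, π (k + N) i * (N : ℝ)⁻¹ ^ N := by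
        rw [← Finset.sum_mul, (hπ _).2, one_mul]
    _ ≤ ∑ i, π (k + N) i * M N i j :=
        Finset.sum_le_sum fun i _ => mul_le_mul_of_nonneg_left (hall i) ((hπ _).1 i)

/-- Over one strongly connected graph, the weighted spread of the states around the averages `p`
controls the disagreement between any two agents. -/
theorem sq_norm_sub_le_of_isStronglyConnected {E : Type*} [SeminormedAddCommGroup E]
    {G : ℕ → Digraph (Fin N)} {k : ℕ} (hG : IsStronglyConnected (G k)) (y p : Fin N → E)
    (i j : Fin N) :
    ‖y i - y j‖ ^ 2 ≤ 4 * (N : ℝ) ^ 3 * ∑ i, ∑ l, rowWeights G k i l * ‖y l - p i‖ ^ 2 := by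
  have hN : (0 : ℝ) < N := Nat.cast_pos.2 i.pos
  set T := ∑ i, ∑ l, rowWeights G k i l * ‖y l - p i‖ ^ 2 with hT
  have hterm : ∀ i l, 0 ≤ rowWeights G k i l * ‖y l - p i‖ ^ 2 := fun i l =>
    mul_nonneg (rowWeights_nonneg G k i l) (sq_nonneg _)
  have hT0 : 0 ≤ T := Finset.sum_nonneg fun i _ => Finset.sum_nonneg fun l _ => hterm i l
  set ρ := √(N * T) with hρ
  have hρ0 : 0 ≤ ρ := Real.sqrt_nonneg _
  have hnear : ∀ i l, l ∈ inNbhd (G k) i → ‖y l - p i‖ ≤ ρ := by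
    intro i l hl
    refine Real.le_sqrt_of_sq_le ?_
    have h1 : rowWeights G k i l * ‖y l - p i‖ ^ 2 ≤ T :=
      (Finset.single_le_sum (fun l _ => hterm i l) (Finset.mem_univ l)).trans
        (Finset.single_le_sum (f := fun i => ∑ l, rowWeights G k i l * ‖y l - p i‖ ^ 2)
          (fun i _ => Finset.sum_nonneg fun l _ => hterm i l) (Finset.mem_univ i))
    have h2 : (N : ℝ)⁻¹ * ‖y l - p i‖ ^ 2 ≤ T :=
      (mul_le_mul_of_nonneg_right (inv_le_rowWeights hl) (sq_nonneg _)).trans h1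
    rwa [inv_mul_le_iff₀ hN] at h2
  have hall : ∀ i, ‖y i - y j‖ ≤ (N : ℝ) * (2 * ρ) := by
    refine forall_of_spreading (G := fun _ => G k) (fun _ => hG)
      (A := fun t i => ‖y i - y j‖ ≤ (t : ℝ) * (2 * ρ)) ⟨j, by simp⟩ ?_ ?_
    · intro t i hi
      push_cast
      linarith
    · intro t l i hl hli
      have h1 := hnear i l (mem_inNbhd_of_adj hli)
      have h2 := hnear i i (self_mem_inNbhd _ i)
      have h3 : ‖y i - y j‖ ≤ ‖y i - p i‖ + ‖y l - p i‖ + ‖y l - y j‖ := by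
        have : y i - y j = (y i - p i) - (y l - p i) + (y l - y j) := by abel
        rw [this]
        exact (norm_add_le _ _).trans (add_le_add_left (norm_sub_le _ _) _)
      push_cast
      linarith
  calc ‖y i - y j‖ ^ 2 ≤ ((N : ℝ) * (2 * ρ)) ^ 2 := pow_le_pow_left₀ (norm_nonneg _) (hall i) 2
    _ = 4 * (N : ℝ) ^ 2 * ρ ^ 2 := by ring
    _ = 4 * (N : ℝ) ^ 3 * T := by
      rw [hρ, Real.sq_sqrt (by positivity)]
      ring

end Graph

/-! ### Almost supermartingales -/

section Probability

variable {S : Type*} {mS : MeasurableSpace S} {μ : Measure S}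

/-- Convergence of an almost supermartingale with a deterministic summable error `b`, a gain `Φ`
and noise `ξ` centered given the past. The process need not be integrable: it is only assumed
that the noise is bounded and centered on the events `{V 0 ≤ M}`, to which the martingale
convergence theorem is applied one at a time. -/
theorem ae_tendsto_and_summable_of_almost_supermartingale [IsProbabilityMeasure μ]
    {ℱ : Filtration ℕ mS} {V Φ ξ : ℕ → S → ℝ} {b : ℕ → ℝ}
    (hV : ∀ k, Measurable[ℱ k] (V k)) (hΦ : ∀ k, Measurable[ℱ k] (Φ k))
    (hξ : ∀ k, Measurable (ξ k)) (hV0 : ∀ k w, 0 ≤ V k w) (hΦ0 : ∀ k w, 0 ≤ Φ k w)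
    (hb : Summable b) (hb0 : ∀ k, 0 ≤ b k)
    (hstep : ∀ k w, V (k + 1) w + Φ k w + ξ k w ≤ V k w + b k)
    (hξbd : ∀ M k, ∃ C, ∀ w, V 0 w ≤ M → |ξ k w| ≤ C)
    (hξint : ∀ M k B, MeasurableSet[ℱ k] B → (∀ w ∈ B, V 0 w ≤ M) → ∫ w in B, ξ k w ∂μ = 0) :
    ∀ᵐ w ∂μ, (∃ l, Tendsto (fun k => V k w) atTop (𝓝 l)) ∧ Summable fun k => Φ k w := by
  let Z : ℕ → S → ℝ := fun k w =>
    V k w + ∑ l ∈ Finset.range k, Φ l w + (∑' l, b l - ∑ l ∈ Finset.range k, b l)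
  have hb_tail : ∀ k, 0 ≤ ∑' l, b l - ∑ l ∈ Finset.range k, b l := fun k =>
    sub_nonneg.2 (hb.sum_le_tsum _ fun l _ => hb0 l)
  have hZ0 : ∀ k w, 0 ≤ Z k w := fun k w =>
    add_nonneg (add_nonneg (hV0 k w) (Finset.sum_nonneg fun l _ => hΦ0 l w)) (hb_tail k)
  have hZm : ∀ k, Measurable[ℱ k] (Z k) := by
    intro k
    have h1 : Measurable[ℱ k] fun w => ∑ l ∈ Finset.range k, Φ l w :=
      Finset.measurable_fun_sum _ fun l hl =>
        (hΦ l).mono (ℱ.mono (Finset.mem_range.1 hl).le) le_rfl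
    exact ((hV k).add h1).add_const _
  have hZstep : ∀ k w, Z (k + 1) w ≤ Z k w - ξ k w := by
    intro k w
    simp only [Z, Finset.sum_range_succ]
    linarith [hstep k w]
  have hZbd : ∀ M k, ∃ C, ∀ w, V 0 w ≤ M → Z k w ≤ C := by
    intro M k
    induction k with
    | zero =>
      exact ⟨M + ∑' l, b l, fun w hw => by simpa [Z] using hw⟩
    | succ k ih =>
      obtain ⟨C, hC⟩ := ih
      obtain ⟨C', hC'⟩ := hξbd M k
      refine ⟨C + C', fun w hw => ?_⟩
      linarith [hZstep k w, hC w hw, neg_le_of_abs_le (hC' w hw)]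
  have key : ∀ M : ℕ, ∀ᵐ w ∂μ, V 0 w ≤ M →
      (∃ l, Tendsto (fun k => V k w) atTop (𝓝 l)) ∧ Summable fun k => Φ k w := by
    intro M
    let A : Set S := {w | V 0 w ≤ M}
    have hA : ∀ k, MeasurableSet[ℱ k] A := fun k =>
      ℱ.mono (Nat.zero_le k) _ (measurableSet_le (hV 0) measurable_const)
    let Y : ℕ → S → ℝ := fun k => A.indicator (Z k)
    have hY0 : ∀ k w, 0 ≤ Y k w := fun k w => Set.indicator_nonneg (fun w _ => hZ0 k w) w
    have hYm : ∀ k, Measurable[ℱ k] (Y k) := fun k => (hZm k).indicator (hA k)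
    have hbdd : ∀ {f : S → ℝ}, Measurable f → (∃ C, ∀ w ∈ A, |f w| ≤ C) → IntegrableOn f A μ := by
      rintro f hf ⟨C, hC⟩
      exact Measure.integrableOn_of_bounded (M := C) (measure_ne_top μ A) hf.aestronglyMeasurable
        ((ae_restrict_mem (ℱ.le 0 _ (hA 0))).mono fun w hw => hC w hw)
    have hZint : ∀ k, IntegrableOn (Z k) A μ := by
      intro k
      obtain ⟨C, hC⟩ := hZbd M k
      exact hbdd ((hZm k).mono (ℱ.le k) le_rfl)
        ⟨C, fun w hw => by rw [abs_of_nonneg (hZ0 k w)]; exact hC w hw⟩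
    have hξi : ∀ k, IntegrableOn (ξ k) A μ := by
      intro k
      obtain ⟨C, hC⟩ := hξbd M k
      exact hbdd (hξ k) ⟨C, fun w hw => hC w hw⟩
    have hYint : ∀ k, Integrable (Y k) μ := fun k =>
      (hZint k).integrable_indicator (ℱ.le 0 _ (hA 0))
    have hsuper : Supermartingale Y ℱ μ := by
      refine supermartingale_of_setIntegral_succ_le (fun k => (hYm k).stronglyMeasurable)
        hYint fun k s hs => ?_
      have hmA := ℱ.le 0 _ (hA 0)
      rw [setIntegral_indicator hmA, setIntegral_indicator hmA]
      have hsub : s ∩ A ⊆ A := Set.inter_subset_right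
      calc ∫ w in s ∩ A, Z (k + 1) w ∂μ ≤ ∫ w in s ∩ A, (Z k w - ξ k w) ∂μ :=
            setIntegral_mono ((hZint _).mono_set hsub)
              (((hZint k).mono_set hsub).sub ((hξi k).mono_set hsub)) (hZstep k)
        _ = ∫ w in s ∩ A, Z k w ∂μ := by
            rw [integral_sub ((hZint k).mono_set hsub) ((hξi k).mono_set hsub),
              hξint M k _ (hs.inter (hA k)) fun w hw => hw.2, sub_zero]
    have hmean : ∀ k, ∫ w, Y k w ∂μ ≤ ∫ w, Y 0 w ∂μ := by
      intro k
      simpa using hsuper.setIntegral_le (Nat.zero_le k) (MeasurableSet.univ (α := S))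
    have hnorm : ∀ k, eLpNorm ((-Y) k) 1 μ ≤ ((∫ w, Y 0 w ∂μ).toNNReal : ENNReal) := by
      intro k
      rw [Pi.neg_apply, eLpNorm_neg, eLpNorm_one_eq_lintegral_enorm]
      have : ∀ w, ‖Y k w‖ₑ = ENNReal.ofReal (Y k w) := fun w =>
        Real.enorm_of_nonneg (hY0 k w)
      simp only [this]
      rw [← ofReal_integral_eq_lintegral_ofReal (hYint k) (ae_of_all _ (hY0 k))]
      exact ENNReal.ofReal_le_ofReal (hmean k)
    filter_upwards [hsuper.neg.exists_ae_tendsto_of_bdd hnorm] with w hw hwM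
    obtain ⟨l, hl⟩ := hw
    have hYZ : ∀ k, (-Y) k w = -Z k w := fun k => by
      change -(A.indicator (Z k) w) = _
      rw [Set.indicator_of_mem (show w ∈ A from hwM)]
    simp only [hYZ] at hl
    have hZl : Tendsto (fun k => Z k w) atTop (𝓝 (-l)) := by simpa using hl.neg
    have hsum : Summable fun k => Φ k w := by
      obtain ⟨C, hC⟩ := hZl.bddAbove_range
      refine summable_of_sum_range_le (c := C) (fun k => hΦ0 k w) fun k => ?_
      have h1 : Z k w ≤ C := hC ⟨k, rfl⟩
      have h2 : Z k w = V k w + ∑ l ∈ Finset.range k, Φ l w +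
        (∑' l, b l - ∑ l ∈ Finset.range k, b l) := rfl
      linarith [hV0 k w, hb_tail k]
    refine ⟨⟨_, ((hZl.sub hsum.hasSum.tendsto_sum_nat).sub
      (hb.hasSum.tendsto_sum_nat.const_sub (∑' l, b l))).congr fun k => ?_⟩, hsum⟩
    simp only [Z]
    ring
  filter_upwards [ae_all_iff.2 key] with w hw
  obtain ⟨M, hM⟩ := exists_nat_ge (V 0 w)
  exact hw M hM

theorem eq_sum_indicator_preimage_singleton {S J : Type*} (ω : S → J) (F : Finset J)
    (hF : ∀ w, ω w ∈ F) (φ : J → S → ℝ) (w : S) :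
    φ (ω w) w = ∑ j ∈ F, (ω ⁻¹' {j}).indicator (φ j) w := by
  classical
  rw [Finset.sum_eq_single_of_mem (ω w) (hF w)]
  · simp
  · intro j _ hj
    simp [hj.symm]

theorem measurable_comp_of_forall_mem_finset {J : Type*} [MeasurableSpace J]
    [MeasurableSingletonClass J] {ω : S → J} (hω : Measurable ω) (F : Finset J)
    (hF : ∀ w, ω w ∈ F) (φ : J → S → ℝ) (hφ : ∀ j ∈ F, Measurable (φ j)) :
    Measurable fun w => φ (ω w) w := by
  simp only [eq_sum_indicator_preimage_singleton ω F hF φ]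
  exact Finset.measurable_fun_sum _ fun j hj =>
    (hφ j hj).indicator (hω (measurableSet_singleton j))

/-- If `ω` takes finitely many values and is independent of the past, averaging over `ω` with the
past fixed does not change integrals over past events. -/
theorem setIntegral_comp_eq_of_indep {S : Type*} {m mS : MeasurableSpace S} {μ : Measure S}
    [IsProbabilityMeasure μ] {J : Type*} [MeasurableSpace J] [MeasurableSingletonClass J] (hm : m ≤ mS) {ω : S → J}
    (hω : Measurable ω) (hind : Indep m (MeasurableSpace.comap ω inferInstance) μ)
    (F : Finset J) (hF : ∀ w, ω w ∈ F) (φ : J → S → ℝ) (hφ : ∀ j ∈ F, Measurable[m] (φ j))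
    {B : Set S} (hB : MeasurableSet[m] B) {C : ℝ} (hC : ∀ j ∈ F, ∀ w ∈ B, |φ j w| ≤ C) :
    ∫ w in B, φ (ω w) w ∂μ = ∫ w in B, ∑ j ∈ F, (μ (ω ⁻¹' {j})).toReal * φ j w ∂μ := by
  classical
  have hBm := hm _ hB
  have hmeas : ∀ j ∈ F, Measurable (φ j) := fun j hj => (hφ j hj).mono hm le_rfl
  have hint : ∀ j ∈ F, IntegrableOn (φ j) B μ := fun j hj =>
    Measure.integrableOn_of_bounded (M := C) (measure_ne_top μ B) (hmeas j hj).aestronglyMeasurable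
      ((ae_restrict_mem hBm).mono fun w hw => hC j hj w hw)
  have hωj : ∀ j, MeasurableSet (ω ⁻¹' {j}) := fun j => hω (measurableSet_singleton j)
  have hone : ∀ j ∈ F, ∫ w in B, (ω ⁻¹' {j}).indicator (φ j) w ∂μ
      = (μ (ω ⁻¹' {j})).toReal * ∫ w in B, φ j w ∂μ := by
    intro j hj
    let X : S → ℝ := B.indicator (φ j)
    let T : S → ℝ := (ω ⁻¹' {j}).indicator 1
    have hX : Measurable[m] X := (hφ j hj).indicator hB
    have hT : Measurable[MeasurableSpace.comap ω inferInstance] T := by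
      have h1 : MeasurableSet[MeasurableSpace.comap ω inferInstance] (ω ⁻¹' {j}) :=
        ⟨{j}, measurableSet_singleton j, rfl⟩
      refine Measurable.indicator ?_ h1
      exact @measurable_const _ _ _ (_) 1
    have hXT : IndepFun X T μ := by
      rw [IndepFun_iff_Indep]
      exact indep_of_indep_of_le_left (indep_of_indep_of_le_right hind hT.comap_le) hX.comap_le
    have h1 := hXT.integral_fun_mul_eq_mul_integral
      ((hX.mono hm le_rfl).aestronglyMeasurable)
      ((hT.mono hω.comap_le le_rfl).aestronglyMeasurable)
    have h2 : ∫ w, T w ∂μ = (μ (ω ⁻¹' {j})).toReal := by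
      simp [T, integral_indicator_one (hωj j), Measure.real]
    have h3 : ∫ w, X w ∂μ = ∫ w in B, φ j w ∂μ := integral_indicator hBm
    rw [h2, h3] at h1
    rw [mul_comm, ← h1, ← integral_indicator hBm]
    congr 1
    ext w
    by_cases hwB : w ∈ B <;> by_cases hwj : ω w = j <;> simp [X, T, hwB, hwj]
  simp only [eq_sum_indicator_preimage_singleton ω F hF φ]
  rw [integral_finsetSum _ fun j hj => (hint j hj).indicator (hωj j),
    integral_finsetSum _ fun j hj => (hint j hj).const_mul _]
  exact Finset.sum_congr rfl fun j hj => by rw [hone j hj, integral_const_mul]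

end Probability

/-! ### Convergence of one realization -/

section Deterministic

theorem exists_strictMono_tendsto_zero {α b : ℕ → ℝ} (hα : ∀ k, 0 ≤ α k) (hα' : ¬ Summable α)
    (hb : ∀ k, 0 ≤ b k) (hs : Summable fun k => α k * b k) :
    ∃ φ : ℕ → ℕ, StrictMono φ ∧ Tendsto (b ∘ φ) atTop (𝓝 0) := by
  have hfreq : ∀ n : ℕ, ∃ᶠ k in atTop, b k < 1 / ((n : ℝ) + 1) := by
    intro n hn
    refine hα' ?_
    have hn' : ∀ᶠ k in atTop, 1 / ((n : ℝ) + 1) ≤ b k := hn.mono fun k hk => not_lt.1 hk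
    rw [eventually_atTop] at hn'
    obtain ⟨K, hK⟩ := hn'
    rw [← summable_nat_add_iff K] at hs ⊢
    refine Summable.of_nonneg_of_le (fun k => hα _) (fun k => ?_) (hs.mul_left ((n : ℝ) + 1))
    have h1 := hK (k + K) (by omega)
    rw [div_le_iff₀ (by positivity)] at h1
    nlinarith [hα (k + K)]
  obtain ⟨φ, hφ, hlt⟩ := extraction_forall_of_frequently hfreq
  exact ⟨φ, hφ, squeeze_zero (fun n => hb _) (fun n => (hlt n).le)
    tendsto_one_div_add_atTop_nhds_zero_nat⟩

variable {E : Type*} [NormedAddCommGroup E] [InnerProductSpace ℝ E] {N : ℕ}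

/-- Convergence to a common minimizer of `⟪c, ·⟫` over `X`. The weighted squared distances to the
points of a dense set `T` of minimizers converge, the agents agree in the limit, approach `X`,
and have approximately optimal cost along a subsequence. A cluster point of that subsequence is a
minimizer, and the convergence of the distances to nearby points of `T` makes it the limit of the
whole sequence. -/
theorem exists_tendsto_of_lyapunov [FiniteDimensional ℝ E] {X : Set E} (hX : IsClosed X) {c : E}
    {Xs T : Set E} (hXs : Xs = {z | z ∈ X ∧ ∀ y ∈ X, ⟪c, z⟫_ℝ ≤ ⟪c, y⟫_ℝ}) (hTX : Xs ⊆ closure T)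
    {z₀ : E} (hz₀ : z₀ ∈ Xs) {δ : ℝ} (hδ : 0 < δ) {π : ℕ → Fin N → ℝ}
    (hπ : ∀ k, π k ∈ stdSimplex ℝ (Fin N)) (hπδ : ∀ k i, δ ≤ π k i) {x : Fin N → ℕ → E}
    (i₀ : Fin N)
    (hV : ∀ z ∈ T, ∃ l, Tendsto (fun k => ∑ i, π k i * ‖x i k - z‖ ^ 2) atTop (𝓝 l))
    (hR : ∀ i, Tendsto (fun k => x i k - x i₀ k) atTop (𝓝 0))
    (hdist : Tendsto (fun k => Metric.infDist (x i₀ k) X) atTop (𝓝 0))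
    {α : ℕ → ℝ} (hα : ∀ k, 0 ≤ α k) (hα' : ¬ Summable α)
    (hF0 : ∀ k, 0 ≤ ⟪c, x i₀ k - z₀⟫_ℝ + ‖c‖ * Metric.infDist (x i₀ k) X)
    (hF : Summable fun k => α k * (⟪c, x i₀ k - z₀⟫_ℝ + ‖c‖ * Metric.infDist (x i₀ k) X)) :
    ∃ y ∈ Xs, ∀ i, Tendsto (x i) atTop (𝓝 y) := by
  have hXne : X.Nonempty := by
    rw [hXs] at hz₀
    exact ⟨z₀, hz₀.1⟩
  -- one agent's distance is controlled by the weighted sum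
  have hle : ∀ z k i, δ * ‖x i k - z‖ ^ 2 ≤ ∑ i, π k i * ‖x i k - z‖ ^ 2 := fun z k i =>
    (mul_le_mul_of_nonneg_right (hπδ k i) (sq_nonneg _)).trans
      (Finset.single_le_sum (f := fun i => π k i * ‖x i k - z‖ ^ 2)
        (fun j _ => mul_nonneg ((hπ k).1 j) (sq_nonneg _)) (Finset.mem_univ i))
  obtain ⟨φ, hφ, hφF⟩ := exists_strictMono_tendsto_zero hα hα' hF0 hF
  have hTne : T.Nonempty := closure_nonempty_iff.1 ⟨z₀, hTX hz₀⟩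
  obtain ⟨a, ha⟩ := hTne
  have hbdd : ∃ r, ∀ k, x i₀ k ∈ Metric.closedBall a r := by
    obtain ⟨l, hl⟩ := hV a ha
    obtain ⟨C, hC⟩ := hl.bddAbove_range
    refine ⟨√(C / δ), fun k => ?_⟩
    rw [mem_closedBall_iff_norm]
    refine Real.le_sqrt_of_sq_le ?_
    rw [le_div_iff₀ hδ, mul_comm]
    exact (hle a k i₀).trans (hC ⟨k, rfl⟩)
  obtain ⟨r, hr⟩ := hbdd
  have : ProperSpace E := FiniteDimensional.proper ℝ E
  obtain ⟨y, -, ψ, hψ, hy⟩ := tendsto_subseq_of_bounded Metric.isBounded_closedBall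
    (fun n => hr (φ n))
  have hφψ : Tendsto (φ ∘ ψ) atTop atTop := hφ.tendsto_atTop.comp hψ.tendsto_atTop
  have hy' : Tendsto (fun n => x i₀ ((φ ∘ ψ) n)) atTop (𝓝 y) := hy
  have hd : Tendsto (fun n => Metric.infDist (x i₀ ((φ ∘ ψ) n)) X) atTop (𝓝 0) :=
    hdist.comp hφψ
  have hyX : y ∈ X := by
    rw [hX.mem_iff_infDist_zero hXne]
    exact tendsto_nhds_unique (((Metric.continuous_infDist_pt X).tendsto y).comp hy') hd
  have hyc : ⟪c, y - z₀⟫_ℝ = 0 := by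
    have h1 : Tendsto (fun n => ⟪c, x i₀ ((φ ∘ ψ) n) - z₀⟫_ℝ
        + ‖c‖ * Metric.infDist (x i₀ ((φ ∘ ψ) n)) X) atTop (𝓝 0) :=
      hφF.comp hψ.tendsto_atTop
    have h2 : Tendsto (fun n => ⟪c, x i₀ ((φ ∘ ψ) n) - z₀⟫_ℝ
        + ‖c‖ * Metric.infDist (x i₀ ((φ ∘ ψ) n)) X) atTop (𝓝 (⟪c, y - z₀⟫_ℝ + ‖c‖ * 0)) :=
      (tendsto_const_nhds.inner (hy'.sub_const z₀)).add (hd.const_mul ‖c‖)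
    simpa using tendsto_nhds_unique h2 h1
  have hys : y ∈ Xs := by
    rw [hXs] at hz₀ ⊢
    refine ⟨hyX, fun u hu => ?_⟩
    rw [inner_sub_right] at hyc
    linarith [hz₀.2 u hu]
  refine ⟨y, hys, fun i => ?_⟩
  rw [Metric.tendsto_atTop]
  intro η hη
  set q := √(2 / δ) with hq
  have hq0 : 0 ≤ q := Real.sqrt_nonneg _
  set ε := η / (1 + q) with hε
  have hε0 : 0 < ε := by positivity
  obtain ⟨z, hzT, hz⟩ := Metric.mem_closure_iff.1 (hTX hys) ε hε0
  obtain ⟨l, hl⟩ := hV z hzT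
  have hlε : l ≤ ε ^ 2 := by
    refine le_of_tendsto (hl.comp hφψ) ?_
    have hnear : ∀ j, ∀ᶠ n in atTop, ‖x j ((φ ∘ ψ) n) - z‖ < ε := by
      intro j
      have h1 : Tendsto (fun n => x j ((φ ∘ ψ) n) - z) atTop (𝓝 (0 + y - z)) := by
        have := (((hR j).comp hφψ).add hy').sub_const z
        refine this.congr fun n => ?_
        simp
      rw [zero_add] at h1
      refine h1.norm.eventually_lt_const ?_
      rwa [← dist_eq_norm]
    filter_upwards [eventually_all.2 hnear] with n hn
    calc ∑ i, π ((φ ∘ ψ) n) i * ‖x i ((φ ∘ ψ) n) - z‖ ^ 2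
        ≤ ∑ i, π ((φ ∘ ψ) n) i * ε ^ 2 := Finset.sum_le_sum fun i _ =>
          mul_le_mul_of_nonneg_left (pow_le_pow_left₀ (norm_nonneg _) (hn i).le 2) ((hπ _).1 i)
      _ = ε ^ 2 := by rw [← Finset.sum_mul, (hπ _).2, one_mul]
  have hev : ∀ᶠ k in atTop, ∑ i, π k i * ‖x i k - z‖ ^ 2 < 2 * ε ^ 2 :=
    hl.eventually_lt_const (by nlinarith [pow_pos hε0 2])
  obtain ⟨K, hK⟩ := eventually_atTop.1 hev
  refine ⟨K, fun k hk => ?_⟩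
  have h1 : ‖x i k - z‖ ≤ q * ε := by
    have h2 : ‖x i k - z‖ ^ 2 ≤ 2 / δ * ε ^ 2 := by
      rw [div_mul_eq_mul_div, le_div_iff₀ hδ]
      linarith [hle z k i, hK k hk]
    calc ‖x i k - z‖ ≤ √(2 / δ * ε ^ 2) := Real.le_sqrt_of_sq_le h2
      _ = q * ε := by rw [Real.sqrt_mul (by positivity), Real.sqrt_sq hε0.le]
  calc dist (x i k) y ≤ dist (x i k) z + dist z y := dist_triangle _ _ _
    _ < q * ε + ε := by
        rw [dist_eq_norm, dist_comm z y]
        exact add_lt_add_of_le_of_lt h1 hz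
    _ = η := by
        rw [hε]
        field_simp
        ring

end Deterministic

/-! ### One iteration for a common linear objective -/

namespace Problem

variable {E : Type*} {N : ℕ} {I : Type*}

/-- Expected squared violation at `x` of a constraint of agent `i` drawn from `q i`. -/
noncomputable def violation (P : Problem E N I) (q : Fin N → PMF I) (i : Fin N) (x : E) : ℝ :=
  ∑ j ∈ P.Ω i, (q i j).toReal * P.gPlus j x ^ 2

theorem gPlus_nonneg (P : Problem E N I) (j : I) (x : E) : 0 ≤ P.gPlus j x := le_max_right _ _

theorem violation_nonneg (P : Problem E N I) (q : Fin N → PMF I) (i : Fin N) (x : E) :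
    0 ≤ P.violation q i x :=
  Finset.sum_nonneg fun _ _ => mul_nonneg ENNReal.toReal_nonneg (sq_nonneg _)

theorem gPlus_eq_zero_of_mem_feasible {P : Problem E N I} {z : E} (hz : z ∈ P.feasible)
    {i : Fin N} {j : I} (hj : j ∈ P.Ω i) : P.gPlus j z = 0 :=
  max_eq_right (Set.mem_iInter.1 hz.2 i j hj)

end Problem

section Linear

variable {E : Type*} [NormedAddCommGroup E] [InnerProductSpace ℝ E] {N : ℕ} {I : Type*}

namespace Problem

/-- All agents have the same linear objective `⟪c₀, ·⟫`, and the constraints are regular. The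
bound `C` on the subgradients of `g⁺` is only asked for at violated constraints, where `g⁺`
coincides with `g`. -/
structure IsLinearRegular (P : Problem E N I) (c₀ : E) (C : ℝ) : Prop where
  objective_eq : ∀ i, P.f i = fun y => ⟪c₀, y⟫_ℝ
  nonempty : P.X₀.Nonempty
  isClosed : IsClosed P.X₀
  convex : Convex ℝ P.X₀
  isOpen_domain : IsOpen P.D
  subset_domain : P.X₀ ⊆ P.D
  convex_g : ∀ i, ∀ ω ∈ P.Ω i, ConvexOn ℝ P.D (P.g ω)
  pos : 0 < C
  bounded : ∀ i, ∀ ω ∈ P.Ω i, ∀ x ∈ P.X₀, 0 < P.gPlus ω x →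
    ∀ d ∈ subdifferential P.D (P.gPlus ω) x, ‖d‖ ≤ C

namespace IsLinearRegular

variable {P : Problem E N I} {c₀ : E} {C : ℝ}

theorem gPlus_sub_le [FiniteDimensional ℝ E] (h : P.IsLinearRegular c₀ C) {i : Fin N} {j : I}
    (hj : j ∈ P.Ω i) {x y : E} (hx : x ∈ P.X₀) (hy : y ∈ P.X₀) :
    P.gPlus j x - P.gPlus j y ≤ C * ‖x - y‖ := by
  rcases (P.gPlus_nonneg j x).eq_or_lt with h0 | hpos
  · rw [← h0]
    have := P.gPlus_nonneg j y
    have := mul_nonneg h.pos.le (norm_nonneg (x - y))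
    linarith
  · have hconv : ConvexOn ℝ P.D (P.gPlus j) :=
      (h.convex_g i j hj).sup (convexOn_const 0 (h.convex_g i j hj).1)
    exact sub_le_of_subdifferential_bounded h.isOpen_domain hconv (h.subset_domain hx)
      (h.subset_domain hy) (h.bounded i j hj x hx hpos)

/-- On `X₀`, the violation `g⁺` agrees with a continuous function on the whole space. -/
theorem exists_continuous_eqOn_gPlus [FiniteDimensional ℝ E] (h : P.IsLinearRegular c₀ C)
    {i : Fin N} {j : I} (hj : j ∈ P.Ω i) :
    ∃ φ : E → ℝ, Continuous φ ∧ Set.EqOn (P.gPlus j) φ P.X₀ := by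
  have hlip : LipschitzOnWith C.toNNReal (P.gPlus j) P.X₀ := by
    refine LipschitzOnWith.of_dist_le_mul fun x hx y hy => ?_
    rw [Real.coe_toNNReal _ h.pos.le, Real.dist_eq, dist_eq_norm, abs_le]
    have h1 := h.gPlus_sub_le hj hx hy
    have h2 := h.gPlus_sub_le hj hy hx
    rw [norm_sub_rev] at h2
    constructor <;> linarith
  obtain ⟨φ, hφ, heq⟩ := hlip.extend_real
  exact ⟨φ, hφ.continuous, heq⟩

theorem isClosed_feasible [FiniteDimensional ℝ E] (h : P.IsLinearRegular c₀ C) :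
    IsClosed P.feasible := by
  have heq : P.feasible = P.X₀ ∩ ⋂ i, ⋂ j ∈ P.Ω i, P.X₀ ∩ P.gPlus j ⁻¹' {0} := by
    ext x
    simp only [feasible, localSet, gPlus, Set.mem_inter_iff, Set.mem_iInter, Set.mem_ofPred_eq,
      Set.mem_preimage, Set.mem_singleton_iff, max_eq_right_iff]
    exact ⟨fun hx => ⟨hx.1, fun i j hj => ⟨hx.1, hx.2 i j hj⟩⟩,
      fun hx => ⟨hx.1, fun i j hj => (hx.2 i j hj).2⟩⟩
  rw [heq]
  refine h.isClosed.inter (isClosed_iInter fun i => isClosed_iInter fun j =>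
    isClosed_iInter fun hj => ?_)
  obtain ⟨φ, hφ, hφe⟩ := h.exists_continuous_eqOn_gPlus hj
  exact (hφ.continuousOn.congr hφe).preimage_isClosed_of_isClosed h.isClosed isClosed_singleton

/-- Violations at two points of `X₀` compare up to the squared distance of the points. -/
theorem violation_le [FiniteDimensional ℝ E] (h : P.IsLinearRegular c₀ C) (q : Fin N → PMF I)
    (i : Fin N) {x y : E} (hx : x ∈ P.X₀) (hy : y ∈ P.X₀) :
    P.violation q i x ≤ 2 * P.violation q i y + 2 * C ^ 2 * ‖x - y‖ ^ 2 := by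
  have hq : ∑ j ∈ P.Ω i, (q i j).toReal ≤ 1 := by
    rw [← ENNReal.toReal_sum fun j _ => (q i).apply_ne_top j]
    refine ENNReal.toReal_le_of_le_ofReal zero_le_one ?_
    rw [ENNReal.ofReal_one, ← (q i).tsum_coe]
    exact ENNReal.sum_le_tsum _
  have hj : ∀ j ∈ P.Ω i, (q i j).toReal * P.gPlus j x ^ 2 ≤
      2 * ((q i j).toReal * P.gPlus j y ^ 2) + (q i j).toReal * (2 * C ^ 2 * ‖x - y‖ ^ 2) := by
    intro j hj
    have h1 := h.gPlus_sub_le hj hx hy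
    have h2 : P.gPlus j x ^ 2 ≤ 2 * P.gPlus j y ^ 2 + 2 * C ^ 2 * ‖x - y‖ ^ 2 := by
      have h3 : P.gPlus j x ^ 2 ≤ (P.gPlus j y + C * ‖x - y‖) ^ 2 :=
        pow_le_pow_left₀ (P.gPlus_nonneg j x) (by linarith) 2
      nlinarith [sq_nonneg (P.gPlus j y - C * ‖x - y‖)]
    have h4 := mul_le_mul_of_nonneg_left h2 (ENNReal.toReal_nonneg (a := q i j))
    linarith
  calc P.violation q i x ≤ ∑ j ∈ P.Ω i, (2 * ((q i j).toReal * P.gPlus j y ^ 2)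
        + (q i j).toReal * (2 * C ^ 2 * ‖x - y‖ ^ 2)) := Finset.sum_le_sum hj
    _ = 2 * P.violation q i y
        + (∑ j ∈ P.Ω i, (q i j).toReal) * (2 * C ^ 2 * ‖x - y‖ ^ 2) := by
      rw [Finset.sum_add_distrib, ← Finset.mul_sum, ← Finset.sum_mul]
      rfl
    _ ≤ 2 * P.violation q i y + 2 * C ^ 2 * ‖x - y‖ ^ 2 := by
      have := mul_le_mul_of_nonneg_right hq (show 0 ≤ 2 * C ^ 2 * ‖x - y‖ ^ 2 by positivity)
      linarith

end IsLinearRegular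

end Problem

/-- Bias-variance decomposition for the average of `y` with weights `u`. -/
theorem sq_norm_average_sub {u : Fin N → ℝ} (hu : ∑ j, u j = 1) (y : Fin N → E) {p : E}
    (hp : p = ∑ j, u j • y j) (z : E) :
    ‖p - z‖ ^ 2 = ∑ j, u j * ‖y j - z‖ ^ 2 - ∑ j, u j * ‖y j - p‖ ^ 2 := by
  have h1 : ∀ j, ‖y j - z‖ ^ 2 = ‖y j - p‖ ^ 2 + 2 * ⟪y j - p, p - z⟫_ℝ + ‖p - z‖ ^ 2 := by
    intro j
    rw [← norm_add_sq_real]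
    congr 2
    abel
  have h2 : ∑ j, u j * ⟪y j - p, p - z⟫_ℝ = 0 := by
    simp only [← real_inner_smul_left]
    rw [← sum_inner]
    simp only [smul_sub, Finset.sum_sub_distrib, ← Finset.sum_smul, hu, one_smul, ← hp, sub_self,
      inner_zero_left]
  have h3 : ∑ j, u j * ‖y j - z‖ ^ 2 = ∑ j, u j * ‖y j - p‖ ^ 2
      + 2 * ∑ j, u j * ⟪y j - p, p - z⟫_ℝ + (∑ j, u j) * ‖p - z‖ ^ 2 := by
    rw [Finset.mul_sum, Finset.sum_mul, ← Finset.sum_add_distrib, ← Finset.sum_add_distrib]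
    exact Finset.sum_congr rfl fun j _ => by rw [h1 j]; ring
  rw [h3, h2, hu]
  ring

namespace IsDAP

variable {P : Problem E N I} {c₀ : E} {C : ℝ} {G : ℕ → Digraph (Fin N)} {α : ℕ → ℝ}
  {ω : Fin N → ℕ → I} {x p s v d : Fin N → ℕ → E}

theorem iterate_mem {W : ℕ → Matrix (Fin N) (Fin N) ℝ} (h : IsDAP P W α ω x p s v d) (i : Fin N) :
    ∀ k, x i k ∈ P.X₀
  | 0 => h.init i
  | k + 1 => (h.feasibility i k).1

theorem average_mem (h : IsDAP P (rowWeights G) α ω x p s v d) (hP : P.IsLinearRegular c₀ C)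
    (i : Fin N) (k : ℕ) : p i (k + 1) ∈ P.X₀ := by
  rw [h.average]
  exact hP.convex.sum_mem (fun j _ => rowWeights_nonneg G _ i j) (sum_rowWeights G _ i)
    fun j _ => h.iterate_mem j k

theorem descent_eq (h : IsDAP P (rowWeights G) α ω x p s v d) (hP : P.IsLinearRegular c₀ C)
    (i : Fin N) (k : ℕ) :
    IsProjection P.X₀ (p i (k + 1) - α (k + 1) • c₀) (v i (k + 1)) := by
  have hs := h.subgrad_f i k
  rw [hP.objective_eq] at hs
  have := eq_of_mem_subdifferential_inner hP.isOpen_domain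
    (hP.subset_domain (h.average_mem hP i k)) hs
  rw [← this]
  exact h.descent i k

/-- Effect of one iteration of agent `i` on the squared distance to a feasible point. -/
theorem sq_norm_sub_le (h : IsDAP P (rowWeights G) α ω x p s v d) (hP : P.IsLinearRegular c₀ C)
    {z : E} (hz : z ∈ P.feasible) (i : Fin N) (k : ℕ) (hω : ω i (k + 1) ∈ P.Ω i) :
    ‖x i (k + 1) - z‖ ^ 2 ≤ ∑ j, rowWeights G (k + 1) i j * ‖x j k - z‖ ^ 2
      - ∑ j, rowWeights G (k + 1) i j * ‖x j k - p i (k + 1)‖ ^ 2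
      - 2 * α (k + 1) * ⟪c₀, p i (k + 1) - z⟫_ℝ + α (k + 1) ^ 2 * ‖c₀‖ ^ 2
      - P.gPlus (ω i (k + 1)) (v i (k + 1)) ^ 2 / C ^ 2 := by
  have hv := h.descent_eq hP i k
  have h1 := IsProjection.sq_norm_sub_le_of_polyak hP.convex hP.subset_domain
    (φ := P.gPlus (ω i (k + 1))) hz.1 (Problem.gPlus_eq_zero_of_mem_feasible hz hω)
    (P.gPlus_nonneg _ _) (C := C)
    (fun hpos => ⟨h.subgrad_g i k hpos,
      hP.bounded i _ hω _ hv.1 hpos _ (h.subgrad_g i k hpos)⟩) (h.feasibility i k)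
  have h2 := pow_le_pow_left₀ (norm_nonneg _) (hv.norm_sub_le_of_mem hP.convex hz.1) 2
  have h3 : ‖p i (k + 1) - α (k + 1) • c₀ - z‖ ^ 2 = ‖p i (k + 1) - z‖ ^ 2
      - 2 * α (k + 1) * ⟪c₀, p i (k + 1) - z⟫_ℝ + α (k + 1) ^ 2 * ‖c₀‖ ^ 2 := by
    rw [show p i (k + 1) - α (k + 1) • c₀ - z = (p i (k + 1) - z) - α (k + 1) • c₀ by abel,
      norm_sub_sq_real, real_inner_smul_right, real_inner_comm c₀, norm_smul, mul_pow,
      Real.norm_eq_abs, sq_abs]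
    ring
  have h4 := sq_norm_average_sub (sum_rowWeights G (k + 1) i) (fun j => x j k) (h.average i k) z
  linarith

theorem norm_descent_sub_le (h : IsDAP P (rowWeights G) α ω x p s v d)
    (hP : P.IsLinearRegular c₀ C) (hα : ∀ k, 0 ≤ α k) {z : E} (hz : z ∈ P.X₀) (i : Fin N)
    (k : ℕ) : ‖v i (k + 1) - z‖ ≤ ‖p i (k + 1) - z‖ + α (k + 1) * ‖c₀‖ := by
  refine ((h.descent_eq hP i k).norm_sub_le_of_mem hP.convex hz).trans ?_
  rw [show p i (k + 1) - α (k + 1) • c₀ - z = (p i (k + 1) - z) - α (k + 1) • c₀ by abel]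
  refine (norm_sub_le _ _).trans ?_
  rw [norm_smul, Real.norm_of_nonneg (hα _)]

/-- The Lyapunov inequality along one realization. The Lyapunov function is the squared distance
of the iterates to a feasible point `z`, weighted by the absolute probability sequence, which
absorbs the averaging. The last term on the left is centered given the past; the constant `ε`
trades the cross terms, linear in the step size, for squares. -/
theorem lyapunov_step [FiniteDimensional ℝ E] (h : IsDAP P (rowWeights G) α ω x p s v d)
    (hP : P.IsLinearRegular c₀ C) (hα : ∀ k, 0 ≤ α k) (hG : ∀ k, IsStronglyConnected (G k))
    (hω : ∀ i k, ω i (k + 1) ∈ P.Ω i) {π : ℕ → Fin N → ℝ}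
    (hπ : ∀ k, π k ∈ stdSimplex ℝ (Fin N))
    (hrec : ∀ k, Matrix.vecMul (π (k + 1)) (rowWeights G (k + 1)) = π k) {δ : ℝ} (hδ : 0 < δ)
    (hπδ : ∀ k i, δ ≤ π k i) {q : Fin N → PMF I} {c : ℝ} (hc : 0 < c)
    (hq : ∀ y ∈ P.X₀, Metric.infDist y P.feasible ^ 2 ≤ c * ∑ i, P.violation q i y)
    {z : E} (hz : z ∈ P.feasible) (i₀ : Fin N) {κ ε : ℝ} (hκ : κ * (4 * (N : ℝ) ^ 4) = δ)
    (hε : 0 < ε) (hε₁ : ε * (1 + 8 * c * C ^ 2 * N) ≤ κ / 2) (hε₂ : 4 * ε * c ≤ δ / C ^ 2)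
    (k : ℕ) :
    ∑ i, π (k + 1) i * ‖x i (k + 1) - z‖ ^ 2
      + (κ / 2 * ∑ i, ‖x i k - x i₀ k‖ ^ 2 + ε * Metric.infDist (x i₀ k) P.feasible ^ 2
        + 2 * α (k + 1) * (⟪c₀, x i₀ k - z⟫_ℝ + ‖c₀‖ * Metric.infDist (x i₀ k) P.feasible))
      + ∑ i, π (k + 1) i * ((P.gPlus (ω i (k + 1)) (v i (k + 1)) ^ 2
        - P.violation q i (v i (k + 1))) / C ^ 2)
    ≤ ∑ i, π k i * ‖x i k - z‖ ^ 2
      + ‖c₀‖ ^ 2 * (1 + 2 / ε + 8 * ε * c * C ^ 2 * N) * α (k + 1) ^ 2 := by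
  have hC := hP.pos
  have hN : (0 : ℝ) < N := Nat.cast_pos.2 i₀.pos
  set a := α (k + 1) with ha
  have ha0 : 0 ≤ a := hα _
  set w := π (k + 1) with hw
  have hw0 : ∀ i, 0 ≤ w i := (hπ (k + 1)).1
  have hw1 : ∑ i, w i = 1 := (hπ (k + 1)).2
  set u := x i₀ k with hu
  set R := ∑ i, ‖x i k - u‖ ^ 2 with hR
  set r := Metric.infDist u P.feasible with hr
  set Sp : Fin N → ℝ := fun i =>
    ∑ j, rowWeights G (k + 1) i j * ‖x j k - p i (k + 1)‖ ^ 2 with hSp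
  set H : ℝ := ∑ i, P.violation q i (v i (k + 1)) with hH
  have hSp0 : ∀ i, 0 ≤ Sp i := fun i =>
    Finset.sum_nonneg fun j _ => mul_nonneg (rowWeights_nonneg G _ i j) (sq_nonneg _)
  have hR0 : 0 ≤ R := Finset.sum_nonneg fun i _ => sq_nonneg _
  have hH0 : 0 ≤ H := Finset.sum_nonneg fun i _ => P.violation_nonneg q i _
  -- the averages stay close to the reference agent
  have hpu : ∀ i, ‖p i (k + 1) - u‖ ^ 2 ≤ R := by
    intro i
    have h1 := sq_norm_average_sub (sum_rowWeights G (k + 1) i) (fun j => x j k) (h.average i k) u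
    have h2 : ∑ j, rowWeights G (k + 1) i j * ‖x j k - u‖ ^ 2 ≤ R := by
      refine Finset.sum_le_sum fun j _ => mul_le_of_le_one_left (sq_nonneg _) ?_
      rw [← sum_rowWeights G (k + 1) i]
      exact Finset.single_le_sum (fun l _ => rowWeights_nonneg G _ i l) (Finset.mem_univ j)
    have h3 := hSp0 i
    simp only [hSp] at h3
    linarith
  -- strong connectivity turns the spread of the averages into disagreement
  have hspread : κ * R ≤ ∑ i, w i * Sp i := by
    have h1 : R ≤ 4 * (N : ℝ) ^ 4 * ∑ i, Sp i := by
      calc R ≤ ∑ _i : Fin N, 4 * (N : ℝ) ^ 3 * ∑ i, Sp i := Finset.sum_le_sum fun i _ =>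
            sq_norm_sub_le_of_isStronglyConnected (hG (k + 1)) (fun j => x j k)
              (fun i => p i (k + 1)) i i₀
        _ = 4 * (N : ℝ) ^ 4 * ∑ i, Sp i := by
            rw [Finset.sum_const, Finset.card_univ, Fintype.card_fin, nsmul_eq_mul]
            ring
    have hκ0 : 0 < κ := by
      by_contra! hneg
      have : κ * (4 * (N : ℝ) ^ 4) ≤ 0 := mul_nonpos_of_nonpos_of_nonneg hneg (by positivity)
      linarith
    calc κ * R ≤ κ * (4 * (N : ℝ) ^ 4 * ∑ i, Sp i) := mul_le_mul_of_nonneg_left h1 hκ0.le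
      _ = ∑ i, δ * Sp i := by rw [← mul_assoc, hκ, Finset.mul_sum]
      _ ≤ ∑ i, w i * Sp i :=
          Finset.sum_le_sum fun i _ => mul_le_mul_of_nonneg_right (hπδ _ i) (hSp0 i)
  -- Young's inequality
  have young : ∀ b : ℝ, 2 * a * ‖c₀‖ * b ≤ a ^ 2 * ‖c₀‖ ^ 2 / ε + ε * b ^ 2 := by
    intro b
    have h1 : a ^ 2 * ‖c₀‖ ^ 2 / ε + ε * b ^ 2 - 2 * a * ‖c₀‖ * b
        = (a * ‖c₀‖ - ε * b) ^ 2 / ε := by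
      field_simp
      ring
    have h2 : 0 ≤ (a * ‖c₀‖ - ε * b) ^ 2 / ε := by positivity
    linarith
  have hcost : ∀ i, -(2 * a * ⟪c₀, p i (k + 1) - z⟫_ℝ) ≤ a ^ 2 * ‖c₀‖ ^ 2 / ε + ε * R
      - 2 * a * ⟪c₀, u - z⟫_ℝ := by
    intro i
    have h1 : ⟪c₀, p i (k + 1) - z⟫_ℝ = ⟪c₀, p i (k + 1) - u⟫_ℝ + ⟪c₀, u - z⟫_ℝ := by
      rw [← inner_add_right]
      congr 1
      abel
    have h2 := neg_le_of_abs_le (abs_real_inner_le_norm c₀ (p i (k + 1) - u))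
    have h3 := young ‖p i (k + 1) - u‖
    have h4 := mul_le_mul_of_nonneg_left (hpu i) hε.le
    have h5 := mul_le_mul_of_nonneg_left h2 (by positivity : 0 ≤ 2 * a)
    rw [h1]
    linarith
  have hdist : r ^ 2 ≤ 2 * c * H + 4 * c * C ^ 2 * N * (a ^ 2 * ‖c₀‖ ^ 2 + R) := by
    have hux : u ∈ P.X₀ := h.iterate_mem i₀ k
    have h1 : ∀ i, P.violation q i u ≤ 2 * P.violation q i (v i (k + 1))
        + 2 * C ^ 2 * (2 * (a ^ 2 * ‖c₀‖ ^ 2 + R)) := by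
      intro i
      have h2 := hP.violation_le q i hux (h.descent_eq hP i k).1
      have h3 : ‖u - v i (k + 1)‖ ^ 2 ≤ 2 * (a ^ 2 * ‖c₀‖ ^ 2 + R) := by
        rw [norm_sub_rev]
        have h4 := pow_le_pow_left₀ (norm_nonneg _) (h.norm_descent_sub_le hP hα hux i k) 2
        rw [← ha] at h4
        nlinarith [hpu i, sq_nonneg (‖p i (k + 1) - u‖ - a * ‖c₀‖)]
      have h5 := mul_le_mul_of_nonneg_left h3 (by positivity : 0 ≤ 2 * C ^ 2)
      linarith
    calc r ^ 2 ≤ c * ∑ i, P.violation q i u := hq u hux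
      _ ≤ c * ∑ i, (2 * P.violation q i (v i (k + 1))
          + 2 * C ^ 2 * (2 * (a ^ 2 * ‖c₀‖ ^ 2 + R))) :=
          mul_le_mul_of_nonneg_left (Finset.sum_le_sum fun i _ => h1 i) hc.le
      _ = 2 * c * H + 4 * c * C ^ 2 * N * (a ^ 2 * ‖c₀‖ ^ 2 + R) := by
          rw [Finset.sum_add_distrib, ← Finset.mul_sum, Finset.sum_const, Finset.card_univ,
            Fintype.card_fin, nsmul_eq_mul]
          ring
  have hpast : ∑ i, w i * ∑ j, rowWeights G (k + 1) i j * ‖x j k - z‖ ^ 2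
      = ∑ j, π k j * ‖x j k - z‖ ^ 2 := by
    simp only [← hrec k, Matrix.vecMul, dotProduct, Finset.mul_sum, Finset.sum_mul]
    rw [Finset.sum_comm]
    exact Finset.sum_congr rfl fun j _ => Finset.sum_congr rfl fun i _ => by ring
  have hagent : ∀ i, w i * ‖x i (k + 1) - z‖ ^ 2
      ≤ w i * ∑ j, rowWeights G (k + 1) i j * ‖x j k - z‖ ^ 2 - w i * Sp i
        + w i * (a ^ 2 * ‖c₀‖ ^ 2 / ε + ε * R - 2 * a * ⟪c₀, u - z⟫_ℝ + a ^ 2 * ‖c₀‖ ^ 2)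
        - w i * ((P.gPlus (ω i (k + 1)) (v i (k + 1)) ^ 2
          - P.violation q i (v i (k + 1))) / C ^ 2)
        - δ / C ^ 2 * P.violation q i (v i (k + 1)) := by
    intro i
    have h1 := mul_le_mul_of_nonneg_left (h.sq_norm_sub_le hP hz i k (hω i k)) (hw0 i)
    have h2 := mul_le_mul_of_nonneg_left (hcost i) (hw0 i)
    have h3 : δ * (P.violation q i (v i (k + 1)) / C ^ 2)
        ≤ w i * (P.violation q i (v i (k + 1)) / C ^ 2) :=
      mul_le_mul_of_nonneg_right (hπδ _ i) (div_nonneg (P.violation_nonneg q i _) (sq_nonneg C))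
    have h4 : δ / C ^ 2 * P.violation q i (v i (k + 1))
        = δ * (P.violation q i (v i (k + 1)) / C ^ 2) := by ring
    rw [h4, sub_div]
    simp only [hSp]
    rw [← ha] at h1
    linarith
  have hsum := Finset.sum_le_sum fun i (_ : i ∈ Finset.univ) => hagent i
  simp only [Finset.sum_sub_distrib, Finset.sum_add_distrib, ← Finset.sum_mul, hw1, one_mul,
    hpast, ← Finset.mul_sum] at hsum
  have h1 := young r
  have h2 := mul_le_mul_of_nonneg_left hdist (by positivity : 0 ≤ 2 * ε)
  have h3 := mul_le_mul_of_nonneg_right hε₁ hR0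
  have h4 := mul_le_mul_of_nonneg_right hε₂ hH0
  have h5 : ‖c₀‖ ^ 2 * (1 + 2 / ε + 8 * ε * c * C ^ 2 * N) * a ^ 2
      = a ^ 2 * ‖c₀‖ ^ 2 + 2 * (a ^ 2 * ‖c₀‖ ^ 2 / ε)
        + 8 * ε * c * C ^ 2 * N * (a ^ 2 * ‖c₀‖ ^ 2) := by ring
  rw [h5]
  linarith

/-- Starting at bounded distance from a feasible point, the iterates and the intermediate points
stay at bounded distance, uniformly over the realizations. -/
theorem norm_sub_le (h : IsDAP P (rowWeights G) α ω x p s v d) (hP : P.IsLinearRegular c₀ C)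
    (hα : ∀ k, 0 ≤ α k) (hω : ∀ i k, ω i (k + 1) ∈ P.Ω i) {z : E} (hz : z ∈ P.feasible) {r : ℝ}
    (hr : ∀ i, ‖x i 0 - z‖ ≤ r) (k : ℕ) :
    (∀ i, ‖x i k - z‖ ≤ r + (∑ l ∈ Finset.range k, α (l + 1)) * ‖c₀‖) ∧
      ∀ i, ‖v i (k + 1) - z‖ ≤ r + (∑ l ∈ Finset.range (k + 1), α (l + 1)) * ‖c₀‖ := by
  have hstep : ∀ k, (∀ i, ‖x i k - z‖ ≤ r + (∑ l ∈ Finset.range k, α (l + 1)) * ‖c₀‖) →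
      ∀ i, ‖v i (k + 1) - z‖ ≤ r + (∑ l ∈ Finset.range (k + 1), α (l + 1)) * ‖c₀‖ := by
    intro k hk i
    have h1 := h.norm_descent_sub_le hP hα hz.1 i k
    have h2 : p i (k + 1) ∈ Metric.closedBall z
        (r + (∑ l ∈ Finset.range k, α (l + 1)) * ‖c₀‖) := by
      rw [h.average]
      exact (convex_closedBall z _).sum_mem (fun j _ => rowWeights_nonneg G _ i j)
        (sum_rowWeights G _ i) fun j _ => mem_closedBall_iff_norm.2 (hk j)
    rw [mem_closedBall_iff_norm] at h2
    rw [Finset.sum_range_succ]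
    linarith
  have hall : ∀ k i, ‖x i k - z‖ ≤ r + (∑ l ∈ Finset.range k, α (l + 1)) * ‖c₀‖ := by
    intro k
    induction k with
    | zero => simpa using hr
    | succ k ih =>
      intro i
      refine le_trans ?_ (hstep k ih i)
      have h1 := IsProjection.sq_norm_sub_le_of_polyak hP.convex hP.subset_domain
        (φ := P.gPlus (ω i (k + 1))) hz.1 (Problem.gPlus_eq_zero_of_mem_feasible hz (hω i k))
        (P.gPlus_nonneg _ _) (C := C)
        (fun hpos => ⟨h.subgrad_g i k hpos, hP.bounded i _ (hω i k) _ (h.descent i k).1 hpos _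
          (h.subgrad_g i k hpos)⟩) (h.feasibility i k)
      refine le_of_sq_le_sq ?_ (norm_nonneg _)
      have h2 : 0 ≤ P.gPlus (ω i (k + 1)) (v i (k + 1)) ^ 2 / C ^ 2 := by positivity
      linarith
  exact ⟨hall k, hstep k (hall k)⟩

end IsDAP

end Linear

/-! ### Almost sure convergence for a common linear objective -/

section AlmostSure

theorem inner_add_infDist_nonneg {E : Type*} [NormedAddCommGroup E] [InnerProductSpace ℝ E]
    [FiniteDimensional ℝ E] {X : Set E} (hX : IsClosed X) {c z : E} (hz : z ∈ X)
    (hmin : ∀ y ∈ X, ⟪c, z⟫_ℝ ≤ ⟪c, y⟫_ℝ) (u : E) :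
    0 ≤ ⟪c, u - z⟫_ℝ + ‖c‖ * Metric.infDist u X := by
  have : ProperSpace E := FiniteDimensional.proper ℝ E
  obtain ⟨y, hy, hdist⟩ := hX.exists_infDist_eq_dist ⟨z, hz⟩ u
  have h1 := neg_le_of_abs_le (abs_real_inner_le_norm c (u - y))
  have h2 : ⟪c, u - z⟫_ℝ = ⟪c, u - y⟫_ℝ + (⟪c, y⟫_ℝ - ⟪c, z⟫_ℝ) := by
    simp only [inner_sub_right]
    ring
  rw [hdist, dist_eq_norm, h2]
  linarith [hmin y hy]

variable {E : Type*} [NormedAddCommGroup E] [InnerProductSpace ℝ E] [FiniteDimensional ℝ E]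
  {N : ℕ} {I : Type*} {P : Problem E N I} {c₀ : E} {C : ℝ} {G : ℕ → Digraph (Fin N)} {α : ℕ → ℝ}
  {S : Type*} {ω : Fin N → ℕ → S → I} {x p s v d : Fin N → ℕ → S → E}

/-- The intermediate points `v` at time `k + 1` are known at time `k`: unlike the subgradients
`d`, which need not even be measurable, they are a continuous function of the iterates. -/
theorem stronglyMeasurable_descent
    (hx : ∀ w, IsDAP P (rowWeights G) α (fun i k => ω i k w) (fun i k => x i k w)
      (fun i k => p i k w) (fun i k => s i k w) (fun i k => v i k w) (fun i k => d i k w))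
    (hP : P.IsLinearRegular c₀ C) {m : MeasurableSpace S} {k : ℕ}
    (hm : ∀ i, StronglyMeasurable[m] (x i k)) (i : Fin N) :
    StronglyMeasurable[m] (v i (k + 1)) := by
  have : CompleteSpace E := FiniteDimensional.complete ℝ E
  obtain ⟨proj, hproj, hprojS⟩ := exists_continuous_isProjection hP.nonempty hP.isClosed hP.convex
  have hv : v i (k + 1) = fun w =>
      proj (∑ j, rowWeights G (k + 1) i j • x j k w - α (k + 1) • c₀) := by
    ext w
    have h1 := (hx w).descent_eq hP i k
    rw [(hx w).average] at h1
    exact h1.eq hP.convex (hprojS _)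
  rw [hv]
  refine hproj.comp_stronglyMeasurable (StronglyMeasurable.sub ?_ stronglyMeasurable_const)
  exact Finset.stronglyMeasurable_fun_sum _ fun j _ => (hm j).const_smul _

variable [MeasurableSpace I] {mS : MeasurableSpace S} {μ : Measure S}
  {q : Fin N → PMF I}

theorem IsIIDSampling.sum_eq_one {Ω : Fin N → Finset I} (hω : IsIIDSampling μ Ω q ω)
    (i : Fin N) : ∑ j ∈ Ω i, (q i j).toReal = 1 := by
  have h : ∑' j, q i j = ∑ j ∈ Ω i, q i j := tsum_eq_sum fun j hj => by
    rw [PMF.apply_eq_zero_iff, hω.support]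
    exact hj
  rw [← ENNReal.toReal_sum fun j _ => (q i).apply_ne_top j, ← h, (q i).tsum_coe,
    ENNReal.toReal_one]

variable [MeasurableSingletonClass I]

/-- Almost sure convergence of the weighted squared distance to an optimal point, and almost sure
summability of the gain in the Lyapunov inequality. -/
theorem ae_tendsto_lyapunov_and_summable [IsProbabilityMeasure μ] (hP : P.IsLinearRegular c₀ C)
    (hG : ∀ k, IsStronglyConnected (G k)) (hα : IsStepsize α) (hω : IsIIDSampling μ P.Ω q ω)
    (hx : ∀ w, IsDAP P (rowWeights G) α (fun i k => ω i k w) (fun i k => x i k w)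
      (fun i k => p i k w) (fun i k => s i k w) (fun i k => v i k w) (fun i k => d i k w))
    {ℱ : Filtration ℕ mS} (hℱ : IsHistory μ ℱ ω x) {π : ℕ → Fin N → ℝ}
    (hπ : ∀ k, π k ∈ stdSimplex ℝ (Fin N))
    (hrec : ∀ k, Matrix.vecMul (π (k + 1)) (rowWeights G (k + 1)) = π k) {δ : ℝ} (hδ : 0 < δ)
    (hπδ : ∀ k i, δ ≤ π k i) {c : ℝ} (hc : 0 < c)
    (hq : ∀ y ∈ P.X₀, Metric.infDist y P.feasible ^ 2 ≤ c * ∑ i, P.violation q i y)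
    {z : E} (hz : z ∈ P.feasible) (hmin : ∀ y ∈ P.feasible, ⟪c₀, z⟫_ℝ ≤ ⟪c₀, y⟫_ℝ) (i₀ : Fin N)
    {κ ε : ℝ} (hκ : κ * (4 * (N : ℝ) ^ 4) = δ) (hκ₀ : 0 < κ)
    (hε : 0 < ε) (hε₁ : ε * (1 + 8 * c * C ^ 2 * N) ≤ κ / 2) (hε₂ : 4 * ε * c ≤ δ / C ^ 2) :
    ∀ᵐ w ∂μ, (∃ l, Tendsto (fun k => ∑ i, π k i * ‖x i k w - z‖ ^ 2) atTop (𝓝 l)) ∧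
      Summable fun k => κ / 2 * ∑ i, ‖x i k w - x i₀ k w‖ ^ 2
        + ε * Metric.infDist (x i₀ k w) P.feasible ^ 2
        + 2 * α (k + 1) *
          (⟪c₀, x i₀ k w - z⟫_ℝ + ‖c₀‖ * Metric.infDist (x i₀ k w) P.feasible) := by
  have hC := hP.pos
  have hN : (0 : ℝ) < N := Nat.cast_pos.2 i₀.pos
  have hsm : ∀ i k, StronglyMeasurable[ℱ k] (x i k) := fun i k => hℱ.iterates i k
  have hvm : ∀ i k, StronglyMeasurable[ℱ k] (v i (k + 1)) := fun i k =>
    stronglyMeasurable_descent hx hP (fun j => hsm j k) i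
  have hgm : ∀ i k, ∀ j ∈ P.Ω i, Measurable[ℱ k] fun w => P.gPlus j (v i (k + 1) w) := by
    intro i k j hj
    obtain ⟨φ, hφ, hφe⟩ := hP.exists_continuous_eqOn_gPlus hj
    have : (fun w => P.gPlus j (v i (k + 1) w)) = fun w => φ (v i (k + 1) w) := by
      ext w
      exact hφe ((hx w).descent i k).1
    rw [this]
    exact (hφ.comp_stronglyMeasurable (hvm i k)).measurable
  -- the noise of agent `i` when the index `j` is drawn
  let ζ : Fin N → ℕ → I → S → ℝ := fun i k j w =>
    π (k + 1) i * ((P.gPlus j (v i (k + 1) w) ^ 2 - P.violation q i (v i (k + 1) w)) / C ^ 2)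
  have hζm : ∀ i k, ∀ j ∈ P.Ω i, Measurable[ℱ k] (ζ i k j) := by
    intro i k j hj
    have h1 : Measurable[ℱ k] fun w => P.violation q i (v i (k + 1) w) :=
      Finset.measurable_fun_sum _ fun j hj => ((hgm i k j hj).pow_const 2).const_mul _
    exact ((((hgm i k j hj).pow_const 2).sub h1).div_const _).const_mul _
  have hζbd : ∀ M k, ∃ K, ∀ i, ∀ j ∈ P.Ω i, ∀ w, ∑ i, π 0 i * ‖x i 0 w - z‖ ^ 2 ≤ M →
      |ζ i k j w| ≤ K := by
    intro M k
    set ρ := √(M / δ) + (∑ l ∈ Finset.range (k + 1), α (l + 1)) * ‖c₀‖ with hρ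
    refine ⟨(C * ρ) ^ 2 / C ^ 2, fun i j hj w hw => ?_⟩
    have h1 : ∀ i, ‖x i 0 w - z‖ ≤ √(M / δ) := by
      intro i
      refine Real.le_sqrt_of_sq_le ?_
      rw [le_div_iff₀ hδ, mul_comm]
      refine le_trans ?_ hw
      exact (mul_le_mul_of_nonneg_right (hπδ 0 i) (sq_nonneg _)).trans
        (Finset.single_le_sum (f := fun i => π 0 i * ‖x i 0 w - z‖ ^ 2)
          (fun j _ => mul_nonneg ((hπ 0).1 j) (sq_nonneg _)) (Finset.mem_univ i))
    have h2 := ((hx w).norm_sub_le hP hα.nonneg (fun i k => hω.mem i k w) hz h1 k).2 i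
    have h3 : ∀ j ∈ P.Ω i, P.gPlus j (v i (k + 1) w) ^ 2 ≤ (C * ρ) ^ 2 := by
      intro j hj
      refine pow_le_pow_left₀ (P.gPlus_nonneg _ _) ?_ 2
      have h4 := hP.gPlus_sub_le hj ((hx w).descent i k).1 hz.1
      rw [Problem.gPlus_eq_zero_of_mem_feasible hz hj, sub_zero] at h4
      exact h4.trans (mul_le_mul_of_nonneg_left h2 hC.le)
    have h5 : P.violation q i (v i (k + 1) w) ≤ (C * ρ) ^ 2 := by
      calc P.violation q i (v i (k + 1) w) ≤ ∑ j ∈ P.Ω i, (q i j).toReal * (C * ρ) ^ 2 :=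
            Finset.sum_le_sum fun j hj => mul_le_mul_of_nonneg_left (h3 j hj)
              ENNReal.toReal_nonneg
        _ = (C * ρ) ^ 2 := by rw [← Finset.sum_mul, hω.sum_eq_one, one_mul]
    have h6 := P.violation_nonneg q i (v i (k + 1) w)
    have h7 : |P.gPlus j (v i (k + 1) w) ^ 2 - P.violation q i (v i (k + 1) w)| ≤ (C * ρ) ^ 2 := by
      rw [abs_le]
      constructor <;> linarith [h3 j hj, sq_nonneg (P.gPlus j (v i (k + 1) w))]
    have h8 : π (k + 1) i ≤ 1 := by
      rw [← (hπ (k + 1)).2]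
      exact Finset.single_le_sum (fun j _ => (hπ (k + 1)).1 j) (Finset.mem_univ i)
    simp only [ζ]
    rw [abs_mul, abs_div, abs_of_nonneg ((hπ (k + 1)).1 i), abs_of_nonneg (sq_nonneg C)]
    calc π (k + 1) i *
          (|P.gPlus j (v i (k + 1) w) ^ 2 - P.violation q i (v i (k + 1) w)| / C ^ 2)
        ≤ 1 * ((C * ρ) ^ 2 / C ^ 2) := by gcongr
      _ = (C * ρ) ^ 2 / C ^ 2 := one_mul _
  have hζω : ∀ i k, Measurable fun w => ζ i k (ω i (k + 1) w) w := fun i k =>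
    measurable_comp_of_forall_mem_finset (hω.measurable i k) (P.Ω i) (hω.mem i k) _
      fun j hj => (hζm i k j hj).mono (ℱ.le k) le_rfl
  refine ae_tendsto_and_summable_of_almost_supermartingale (μ := μ) (ℱ := ℱ)
    (ξ := fun k w => ∑ i, ζ i k (ω i (k + 1) w) w)
    (b := fun k => ‖c₀‖ ^ 2 * (1 + 2 / ε + 8 * ε * c * C ^ 2 * N) * α (k + 1) ^ 2)
    ?_ ?_ ?_ ?_ ?_ ?_ ?_ ?_ ?_ ?_
  · intro k
    exact Finset.measurable_fun_sum _ fun i _ =>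
      (((((hsm i k).sub stronglyMeasurable_const).norm).measurable).pow_const 2).const_mul _
  · intro k
    have h1 : Measurable[ℱ k] fun w => ∑ i, ‖x i k w - x i₀ k w‖ ^ 2 :=
      Finset.measurable_fun_sum _ fun i _ =>
        (((hsm i k).sub (hsm i₀ k)).norm.measurable).pow_const 2
    have h2 : Measurable[ℱ k] fun w => Metric.infDist (x i₀ k w) P.feasible :=
      ((Metric.continuous_infDist_pt P.feasible).comp_stronglyMeasurable (hsm i₀ k)).measurable
    have h3 : Measurable[ℱ k] fun w => ⟪c₀, x i₀ k w - z⟫_ℝ :=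
      (Continuous.comp_stronglyMeasurable (g := fun y : E => ⟪c₀, y - z⟫_ℝ) (by fun_prop)
        (hsm i₀ k)).measurable
    exact ((h1.const_mul _).add ((h2.pow_const 2).const_mul _)).add
      ((h3.add (h2.const_mul _)).const_mul _)
  · exact fun k => Finset.measurable_fun_sum _ fun i _ => hζω i k
  · exact fun k w => Finset.sum_nonneg fun i _ => mul_nonneg ((hπ k).1 i) (sq_nonneg _)
  · intro k w
    have h1 := inner_add_infDist_nonneg hP.isClosed_feasible hz hmin (x i₀ k w)
    have h2 : 0 ≤ ∑ i, ‖x i k w - x i₀ k w‖ ^ 2 := Finset.sum_nonneg fun i _ => sq_nonneg _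
    have h3 := hα.nonneg (k + 1)
    positivity
  · exact hα.summable_sq.mul_left _
  · exact fun k => by positivity
  · intro k w
    exact (hx w).lyapunov_step hP hα.nonneg hG (fun i k => hω.mem i k w) hπ hrec hδ hπδ hc hq hz
      i₀ hκ hε hε₁ hε₂ k
  · intro M k
    obtain ⟨K, hK⟩ := hζbd M k
    refine ⟨∑ _i : Fin N, K, fun w hw => ?_⟩
    exact (Finset.abs_sum_le_sum_abs _ _).trans
      (Finset.sum_le_sum fun i _ => hK i _ (hω.mem i k w) w hw)
  · intro M k B hB hBM
    obtain ⟨K, hK⟩ := hζbd M k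
    have hint : ∀ i, IntegrableOn (fun w => ζ i k (ω i (k + 1) w) w) B μ := fun i =>
      Measure.integrableOn_of_bounded (M := K) (measure_ne_top μ B)
        (hζω i k).aestronglyMeasurable
        ((ae_restrict_mem (ℱ.le k _ hB)).mono fun w hw => hK i _ (hω.mem i k w) w (hBM w hw))
    rw [integral_finsetSum _ fun i _ => hint i]
    refine Finset.sum_eq_zero fun i _ => ?_
    have hind : Indep (ℱ k) (MeasurableSpace.comap (ω i (k + 1)) inferInstance) μ :=
      indep_of_indep_of_le_right (hℱ.indep k)
        (le_iSup (fun i => MeasurableSpace.comap (ω i (k + 1)) inferInstance) i)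
    rw [setIntegral_comp_eq_of_indep (ℱ.le k) (hω.measurable i k) hind (P.Ω i) (hω.mem i k)
      (ζ i k) (hζm i k) hB fun j hj w hw => hK i j hj w (hBM w hw)]
    have hzero : ∀ w, ∑ j ∈ P.Ω i, (μ (ω i (k + 1) ⁻¹' {j})).toReal * ζ i k j w = 0 := by
      intro w
      have h1 : ∀ j, (μ (ω i (k + 1) ⁻¹' {j})).toReal * ζ i k j w = π (k + 1) i / C ^ 2 *
          ((q i j).toReal * P.gPlus j (v i (k + 1) w) ^ 2
            - (q i j).toReal * P.violation q i (v i (k + 1) w)) := by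
        intro j
        rw [hω.law]
        simp only [ζ]
        ring
      simp only [h1]
      rw [← Finset.mul_sum, Finset.sum_sub_distrib, ← Finset.sum_mul, hω.sum_eq_one, one_mul]
      simp [Problem.violation]
    simp [hzero]

/-- Almost sure convergence of the algorithm to a common random optimal point, for agents that
share one linear objective. -/
theorem exists_ae_tendsto_of_isLinearRegular [IsProbabilityMeasure μ] [MeasurableSpace E]
    [BorelSpace E] (hN : 0 < N) (hP : P.IsLinearRegular c₀ C) (hopt : P.optimalSet.Nonempty)
    (hG : ∀ k, IsStronglyConnected (G k)) (hα : IsStepsize α) (hω : IsIIDSampling μ P.Ω q ω)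
    (hq : P.ErrorBound q)
    (hx : ∀ w, IsDAP P (rowWeights G) α (fun i k => ω i k w) (fun i k => x i k w)
      (fun i k => p i k w) (fun i k => s i k w) (fun i k => v i k w) (fun i k => d i k w))
    {ℱ : Filtration ℕ mS} (hℱ : IsHistory μ ℱ ω x) :
    ∃ xstar : S → E, Measurable xstar ∧
      ∀ᵐ w ∂μ, xstar w ∈ P.optimalSet ∧ ∀ i, Tendsto (fun k => x i k w) atTop (𝓝 (xstar w)) := by
  have hC := hP.pos
  have hN' : (0 : ℝ) < N := Nat.cast_pos.2 hN
  let i₀ : Fin N := ⟨0, hN⟩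
  have hXs : P.optimalSet = {z | z ∈ P.feasible ∧ ∀ y ∈ P.feasible, ⟪c₀, z⟫_ℝ ≤ ⟪c₀, y⟫_ℝ} := by
    ext z
    simp only [Problem.optimalSet, Problem.objective, hP.objective_eq, Finset.sum_const,
      Finset.card_univ, Fintype.card_fin, nsmul_eq_mul, Set.mem_ofPred_eq, mul_le_mul_iff_right₀ hN']
  obtain ⟨z₀, hz₀⟩ := hopt
  obtain ⟨π, hπ, hrec⟩ := exists_absolute_probability hN (rowWeights G)
    (fun k => rowWeights_nonneg G k) (fun k => sum_rowWeights G k)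
  set δ : ℝ := (N : ℝ)⁻¹ ^ N with hδ
  have hδ0 : 0 < δ := by positivity
  have hπδ := inv_pow_le_absolute_probability hG hπ hrec
  obtain ⟨c, hc, hq⟩ := hq
  set κ : ℝ := δ / (4 * (N : ℝ) ^ 4) with hκ
  have hκ0 : 0 < κ := by positivity
  have hκ1 : κ * (4 * (N : ℝ) ^ 4) = δ := div_mul_cancel₀ _ (by positivity)
  set ε : ℝ := min (κ / 2 / (1 + 8 * c * C ^ 2 * N)) (δ / C ^ 2 / (4 * c)) with hε
  have hε0 : 0 < ε := by positivity
  have hε1 : ε * (1 + 8 * c * C ^ 2 * N) ≤ κ / 2 :=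
    (le_div_iff₀ (by positivity)).1 (min_le_left _ _)
  have hε2 : 4 * ε * c ≤ δ / C ^ 2 := by
    have := (le_div_iff₀ (by positivity)).1 (min_le_right (κ / 2 / (1 + 8 * c * C ^ 2 * N))
      (δ / C ^ 2 / (4 * c)))
    linarith
  have hlyap : ∀ z ∈ P.optimalSet, _ := fun z hz =>
    ae_tendsto_lyapunov_and_summable hP hG hα hω hx hℱ hπ hrec hδ0 hπδ hc hq
      (hXs ▸ hz).1 (hXs ▸ hz).2 i₀ hκ1 hκ0 hε0 hε1 hε2
  have : ProperSpace E := FiniteDimensional.proper ℝ E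
  obtain ⟨T, hTs, hTc, hTd⟩ :=
    (TopologicalSpace.IsSeparable.of_separableSpace P.optimalSet).exists_countable_dense_subset
  have hmain : ∀ᵐ w ∂μ, ∃ y ∈ P.optimalSet, ∀ i, Tendsto (fun k => x i k w) atTop (𝓝 y) := by
    filter_upwards [(ae_ball_iff hTc).2 fun z hz => hlyap z (hTs hz), hlyap z₀ hz₀]
      with w hwT hw₀
    have hF0 : ∀ k, 0 ≤ ⟪c₀, x i₀ k w - z₀⟫_ℝ
        + ‖c₀‖ * Metric.infDist (x i₀ k w) P.feasible := by
      rw [hXs] at hz₀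
      exact fun k => inner_add_infDist_nonneg hP.isClosed_feasible hz₀.1 hz₀.2 _
    have hR0 : ∀ k, 0 ≤ ∑ i, ‖x i k w - x i₀ k w‖ ^ 2 := fun k =>
      Finset.sum_nonneg fun i _ => sq_nonneg _
    have hα0 : ∀ k, 0 ≤ α (k + 1) := fun k => hα.nonneg _
    have hΦ := hw₀.2
    refine exists_tendsto_of_lyapunov hP.isClosed_feasible hXs hTd hz₀ hδ0 hπ hπδ
      (x := fun i k => x i k w) i₀ (fun z hz => (hwT z hz).1) ?_ ?_ hα0 hα.not_summable hF0 ?_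
    · intro i
      have h1 : Summable fun k => κ / 2 * ∑ i, ‖x i k w - x i₀ k w‖ ^ 2 := by
        refine hΦ.of_nonneg_of_le (fun k => mul_nonneg (by positivity) (hR0 k)) fun k => ?_
        have := mul_nonneg (mul_nonneg zero_le_two (hα0 k)) (hF0 k)
        have : 0 ≤ ε * Metric.infDist (x i₀ k w) P.feasible ^ 2 := by positivity
        linarith
      have h2 := ((summable_mul_left_iff (by positivity)).1 h1).tendsto_atTop_zero
      have h3 : Tendsto (fun k => ‖x i k w - x i₀ k w‖ ^ 2) atTop (𝓝 0) :=
        squeeze_zero (fun k => sq_nonneg _) (fun k => Finset.single_le_sum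
          (f := fun i => ‖x i k w - x i₀ k w‖ ^ 2) (fun i _ => sq_nonneg _)
          (Finset.mem_univ i)) h2
      rw [tendsto_zero_iff_norm_tendsto_zero]
      simpa using h3.sqrt
    · have h1 : Summable fun k => ε * Metric.infDist (x i₀ k w) P.feasible ^ 2 := by
        refine hΦ.of_nonneg_of_le (fun k => by positivity) fun k => ?_
        have := mul_nonneg (mul_nonneg zero_le_two (hα0 k)) (hF0 k)
        have := mul_nonneg (by positivity : 0 ≤ κ / 2) (hR0 k)
        linarith
      have h2 := ((summable_mul_left_iff (by positivity)).1 h1).tendsto_atTop_zero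
      simpa [Real.sqrt_sq Metric.infDist_nonneg] using h2.sqrt
    · have h1 : Summable fun k => 2 * (α (k + 1) * (⟪c₀, x i₀ k w - z₀⟫_ℝ
          + ‖c₀‖ * Metric.infDist (x i₀ k w) P.feasible)) := by
        refine hΦ.of_nonneg_of_le
          (fun k => mul_nonneg zero_le_two (mul_nonneg (hα0 k) (hF0 k))) fun k => ?_
        have := mul_nonneg (by positivity : 0 ≤ κ / 2) (hR0 k)
        have : 0 ≤ ε * Metric.infDist (x i₀ k w) P.feasible ^ 2 := by positivity
        linarith
      exact (summable_mul_left_iff two_ne_zero).1 h1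
  obtain ⟨xstar, hmeas, hlim⟩ := measurable_limit_of_tendsto_metrizable_ae (μ := μ)
    (f := fun k w => x i₀ k w) (L := atTop)
    (fun k => ((hℱ.iterates i₀ k).mono (ℱ.le k)).measurable.aemeasurable)
    (hmain.mono fun w ⟨y, _, hy⟩ => ⟨y, hy i₀⟩)
  refine ⟨xstar, hmeas, ?_⟩
  filter_upwards [hmain, hlim] with w ⟨y, hy, hyt⟩ hw
  have heq : xstar w = y := tendsto_nhds_unique hw (hyt i₀)
  rw [heq]
  exact ⟨hy, hyt⟩

end AlmostSure

/-! ### The epigraph form -/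

section Epigraph

variable {n N : ℕ} {I : Type*} {P : Problem (EuclideanSpace ℝ (Fin n)) N I}

theorem inner_epiCost (x : EpiSpace n N) : ⟪epiCost n N, x⟫_ℝ = ∑ i, x.snd i := by
  simp [epiCost, PiLp.inner_apply]

theorem objective_epigraph (x : EpiSpace n N) : P.epigraph.objective x = ∑ i, x.snd i := by
  simp only [Problem.objective, Problem.epigraph, inner_epiCost, Finset.sum_const,
    Finset.card_univ, Fintype.card_fin, nsmul_eq_mul]
  rcases Nat.eq_zero_or_pos N with rfl | hN
  · simp
  · field_simp

theorem mem_feasible_epigraph_iff {x : EpiSpace n N} :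
    x ∈ P.epigraph.feasible ↔ x.fst ∈ P.feasible ∧ ∀ i, P.f i x.fst ≤ x.snd i := by
  simp only [Problem.feasible, Problem.localSet, Problem.epigraph, Set.mem_inter_iff,
    Set.mem_iInter, Set.mem_ofPred_eq, Sum.forall, Finset.inl_mem_disjSum, Finset.inr_mem_disjSum,
    Finset.mem_singleton, Sum.elim_inl, Sum.elim_inr, sub_nonpos, forall_eq, forall_and, and_assoc]

theorem optimalSet_epigraph_nonempty (h : P.optimalSet.Nonempty) :
    P.epigraph.optimalSet.Nonempty := by
  obtain ⟨y, hy, hmin⟩ := h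
  refine ⟨WithLp.toLp 2 (y, WithLp.toLp 2 fun i => P.f i y),
    mem_feasible_epigraph_iff.2 ⟨hy, fun i => le_rfl⟩, fun x hx => ?_⟩
  rw [mem_feasible_epigraph_iff] at hx
  rw [objective_epigraph, objective_epigraph]
  exact (hmin _ hx.1).trans (Finset.sum_le_sum fun i _ => hx.2 i)

/-- A subgradient of the violation of `f i y ≤ t i` at a violated constraint consists of a
subgradient of `f i` and of a vector of norm at most one. Where the constraint is violated, its
`i`-th multiplier is exactly `-1`, and moving `t i` along with `f i y` keeps the violation
constant. -/
theorem subdifferential_epigraph_inr {i : Fin N} {x d : EpiSpace n N} (hxD : x.fst ∈ P.D)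
    (hpos : 0 < P.epigraph.gPlus (Sum.inr i) x)
    (hd : d ∈ subdifferential P.epigraph.D (P.epigraph.gPlus (Sum.inr i)) x) :
    d.fst ∈ subdifferential P.D (P.f i) x.fst ∧ ‖d.snd‖ ≤ 1 := by
  have hg : ∀ z : EpiSpace n N,
      P.epigraph.gPlus (Sum.inr i) z = max (P.f i z.fst - z.snd i) 0 := fun z => rfl
  have hgx : P.epigraph.gPlus (Sum.inr i) x = P.f i x.fst - x.snd i := by
    rw [hg] at hpos ⊢
    exact max_eq_left (by simpa using (lt_max_iff.1 hpos).resolve_right (lt_irrefl _) |>.le)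
  have hsub : ∀ y ∈ P.D, ∀ t : EuclideanSpace ℝ (Fin N), P.f i x.fst - x.snd i
      + (⟪d.fst, y - x.fst⟫_ℝ + ⟪d.snd, t⟫_ℝ) ≤ max (P.f i y - (x.snd i + t i)) 0 := by
    intro y hy t
    have h := hd (WithLp.toLp 2 (y, x.snd + t)) hy
    rw [hgx, hg, WithLp.prod_inner_apply] at h
    simpa using h
  have hnorm : ‖d.snd‖ ≤ 1 := by
    have h1 := hsub x.fst hxD d.snd
    rw [sub_self, inner_zero_right, zero_add, real_inner_self_eq_norm_sq] at h1
    have h2 : ‖d.snd i‖ ≤ ‖d.snd‖ := PiLp.norm_apply_le d.snd i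
    rw [Real.norm_eq_abs] at h2
    have h3 := neg_le_of_abs_le h2
    have h4 : max (P.f i x.fst - (x.snd i + d.snd i)) 0
        ≤ P.f i x.fst - x.snd i + ‖d.snd‖ := by
      refine max_le (by linarith) ?_
      rw [hgx] at hpos
      linarith [norm_nonneg d.snd]
    nlinarith [norm_nonneg d.snd]
  have hinner : ∀ τ : ℝ, ⟪d.snd, EuclideanSpace.single i τ⟫_ℝ = τ * d.snd i := by
    intro τ
    rw [EuclideanSpace.inner_single_right]
    simp
  have hi : d.snd i = -1 := by
    have h1 := hsub x.fst hxD (EuclideanSpace.single i (P.f i x.fst - x.snd i))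
    rw [hinner] at h1
    simp only [sub_self, inner_zero_right, zero_add, PiLp.single_apply, if_true,
      add_sub_cancel, max_self] at h1
    rw [hgx] at hpos
    have h2 : ‖d.snd i‖ ≤ ‖d.snd‖ := PiLp.norm_apply_le d.snd i
    rw [Real.norm_eq_abs] at h2
    have h3 := neg_le_of_abs_le h2
    have h4 : d.snd i ≤ -1 := by
      by_contra! hlt
      nlinarith
    linarith
  refine ⟨fun y hy => ?_, hnorm⟩
  have h1 := hsub y hy (EuclideanSpace.single i (P.f i y - P.f i x.fst))
  rw [hinner, hi] at h1
  simp only [PiLp.single_apply, if_true] at h1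
  have h2 : P.f i y - (x.snd i + (P.f i y - P.f i x.fst)) = P.f i x.fst - x.snd i := by ring
  rw [hgx] at hpos
  rw [h2, max_eq_left hpos.le] at h1
  linarith

theorem subdifferential_epigraph_inl {j : I} {x d : EpiSpace n N} (hxD : x.fst ∈ P.D)
    (hd : d ∈ subdifferential P.epigraph.D (P.epigraph.gPlus (Sum.inl j)) x) :
    d.fst ∈ subdifferential P.D (P.gPlus j) x.fst ∧ d.snd = 0 := by
  have hsub : ∀ y ∈ P.D, ∀ t : EuclideanSpace ℝ (Fin N), P.gPlus j x.fst
      + (⟪d.fst, y - x.fst⟫_ℝ + ⟪d.snd, t⟫_ℝ) ≤ P.gPlus j y := by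
    intro y hy t
    have h := hd (WithLp.toLp 2 (y, x.snd + t)) hy
    rw [WithLp.prod_inner_apply] at h
    simpa [Problem.gPlus, Problem.epigraph] using h
  refine ⟨fun y hy => by simpa using hsub y hy 0, ?_⟩
  have h1 := hsub x.fst hxD d.snd
  rw [sub_self, inner_zero_right, zero_add] at h1
  rw [real_inner_self_eq_norm_sq] at h1
  have h2 : ‖d.snd‖ ^ 2 = 0 := le_antisymm (by linarith) (sq_nonneg _)
  exact norm_eq_zero.1 (pow_eq_zero_iff two_ne_zero |>.1 h2)

theorem Problem.Regular.exists_isLinearRegular_epigraph (hP : P.Regular) :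
    ∃ C, P.epigraph.IsLinearRegular ((1 / (N : ℝ)) • epiCost n N) C := by
  obtain ⟨Cg, hCg⟩ := hP.bounded_g
  choose Cf hCf using hP.bounded_f
  have hfst : IsLinearMap ℝ (WithLp.fst : EpiSpace n N → EuclideanSpace ℝ (Fin n)) :=
    ⟨fun _ _ => rfl, fun _ _ => rfl⟩
  have hconvex : ∀ {φ : EuclideanSpace ℝ (Fin n) → ℝ}, ConvexOn ℝ P.D φ →
      ConvexOn ℝ P.epigraph.D fun x : EpiSpace n N => φ x.fst := fun hφ =>
    hφ.comp_linearMap (hfst.mk' _)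
  refine ⟨|Cg| + ∑ i, |Cf i| + 1, ?_, ?_, ?_, ?_, ?_, ?_, ?_, ?_, ?_⟩
  · intro i
    ext x
    rw [real_inner_smul_left]
    rfl
  · obtain ⟨y, hy⟩ := hP.nonempty
    exact ⟨WithLp.toLp 2 (y, 0), hy⟩
  · exact hP.isClosed.preimage (WithLp.continuous_fst 2 _ _)
  · exact hP.convex.linear_preimage (hfst.mk' _)
  · exact hP.isOpen_domain.preimage (WithLp.continuous_fst 2 _ _)
  · exact fun x hx => hP.subset_domain hx
  · rintro i (j | j) hj
    · exact hconvex (hP.convex_g i j (Finset.inl_mem_disjSum.1 hj))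
    · exact (hconvex (hP.convex_f j)).sub
        ⟨(hconvex (hP.convex_f j)).1, fun x _ y _ a b _ _ _ => le_rfl⟩
  · positivity
  · rintro i (j | j) hj x hx hpos d hd
    · obtain ⟨h1, h2⟩ := subdifferential_epigraph_inl (hP.subset_domain hx) hd
      have h3 := hCg i j (Finset.inl_mem_disjSum.1 hj) _ hx _ h1
      have h4 : ‖d‖ = ‖d.fst‖ := by
        rw [WithLp.prod_norm_eq_of_L2, h2]
        simp
      have h5 : 0 ≤ ∑ i, |Cf i| := Finset.sum_nonneg fun i _ => abs_nonneg _
      rw [h4]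
      linarith [le_abs_self Cg]
    · obtain ⟨h1, h2⟩ := subdifferential_epigraph_inr (hP.subset_domain hx) hpos hd
      have h3 := hCf j _ hx _ h1
      have h4 : |Cf j| ≤ ∑ i, |Cf i| :=
        Finset.single_le_sum (f := fun i => |Cf i|) (fun i _ => abs_nonneg _) (Finset.mem_univ j)
      have h5 : ‖d‖ ≤ ‖d.fst‖ + ‖d.snd‖ := by
        rw [WithLp.prod_norm_eq_of_L2]
        refine Real.sqrt_le_iff.2 ⟨by positivity, ?_⟩
        nlinarith [norm_nonneg d.fst, norm_nonneg d.snd]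
      linarith [le_abs_self (Cf j), abs_nonneg Cg]

theorem measurableSingletonClass_sum {A B : Type*} [MeasurableSpace A] [MeasurableSpace B]
    [MeasurableSingletonClass A] [MeasurableSingletonClass B] :
    MeasurableSingletonClass (A ⊕ B) where
  measurableSet_singleton := by
    rintro (a | b)
    · rw [← Set.image_singleton]
      exact (measurableSet_singleton a).inl_image
    · rw [← Set.image_singleton]
      exact (measurableSet_singleton b).inr_image

end Epigraph

end DAP

theorem proposition2 {n N : ℕ} {I : Type*} [MeasurableSpace I] [DiscreteMeasurableSpace I]
    (P : DAP.Problem (EuclideanSpace ℝ (Fin n)) N I)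
    (hP : P.Regular) (hopt : P.optimalSet.Nonempty)
    (G : ℕ → Digraph (Fin N)) (hG : DAP.IsQStronglyConnected 1 G)
    (α : ℕ → ℝ) (hα : DAP.IsStepsize α)
    {S : Type*} {mS : MeasurableSpace S} (μ : Measure S) [IsProbabilityMeasure μ]
    (q : Fin N → PMF (I ⊕ Fin N)) (ω : Fin N → ℕ → S → I ⊕ Fin N)
    (hω : DAP.IsIIDSampling μ P.epigraph.Ω q ω)
    (hq : P.epigraph.ErrorBound q)
    (x p s v d : Fin N → ℕ → S → DAP.EpiSpace n N)
    (hx : ∀ w, DAP.IsDAP P.epigraph (DAP.rowWeights G) α (fun i k => ω i k w)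
      (fun i k => x i k w) (fun i k => p i k w) (fun i k => s i k w)
      (fun i k => v i k w) (fun i k => d i k w))
    (ℱ : Filtration ℕ mS) (hℱ : DAP.IsHistory μ ℱ ω x) :
    ∃ xstar : S → DAP.EpiSpace n N, Measurable xstar ∧
      ∀ᵐ w ∂μ, xstar w ∈ P.epigraph.optimalSet ∧
        ∀ i, Tendsto (fun k => x i k w) atTop (𝓝 (xstar w)) := by
  rcases Nat.eq_zero_or_pos N with rfl | hN
  · obtain ⟨y, hy⟩ := DAP.optimalSet_epigraph_nonempty hopt
    exact ⟨fun _ => y, measurable_const, ae_of_all _ fun w => ⟨hy, fun i => i.elim0⟩⟩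
  · obtain ⟨C, hC⟩ := hP.exists_isLinearRegular_epigraph
    have : MeasurableSingletonClass (I ⊕ Fin N) := DAP.measurableSingletonClass_sum
    exact DAP.exists_ae_tendsto_of_isLinearRegular hN hC (DAP.optimalSet_epigraph_nonempty hopt)
      hG.isStronglyConnected hα hω hq hx hℱ
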